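/- Consider a downlink with an $N$-antenna transmitter and $K$ single-antenna users, numbered from an infinite list of users (the system with $K$ users consists of the first $K$ of them). The channel ${\bf h}_i\in\mathbb C^N$ of user $i$ has entries with the Shadowed-Rician law ${\rm SR}(m_i,\Omega_i,b_i)$, i.e. the law of $Z+S$ with $Z\sim{\rm Nakagami}(m_i,\Omega_i)$ and $S\sim\mathcal{CN}(0,2b_i)$ independent; the transmitter knows only $\hat{\bf h}_i={\bf h}_i+\tilde{\bf h}_i$ with $\tilde{\bf h}_i\sim\mathcal{CN}({\bf 0},\sigma_{e_i}^2{\bf I}_N)$, and all channel entries and error entries are mutually independent. Assume that the parameters do not depend on $N,K$, that $\Omega_i>0$, $b_i\ge 0$, $\sigma_{e_i}^2\ge0$, that $\inf_i m_i>0$ and $\sup_i b_i/\Omega_i<\infty$, and that $P_t>0$, $\rho\in[0,1]$; put $\bar\rho=1-\rho$. Let the common precoder be ${\bf w}_c=\sum_{i=1}^K\hat{\bf h}_i^*$ (MRT) and the private precoders be ${\bf w}_i=\hat{\bf h}_i^*$ (MF), ${\bf W}=[{\bf w}_c,{\bf w}_1,\dots,{\bf w}_K]$, ${\bf P}={\rm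 Diag}(\sqrt\rho,\sqrt{\bar\rho},\dots,\sqrt{\bar\rho})$ and $\alpha=P_t/\mathbb E\{{\rm Tr}({\bf W}^H{\bf W}{\bf P}^2)\}$. Fix a user $k$ with noise variance $\sigma_k^2>0$, let $$\gamma_k^{(c)}=\frac{\alpha\rho\,|{\bf h}_k^T\sum_{i=1}^K{\bf h}_i^*|^2+\alpha\rho\sum_{i=1}^K\sigma_{e_i}^2\|{\bf h}_k\|^2}{\sigma_k^2+\alpha\bar\rho\sum_{i=1}^K(\sigma_{e_i}^2\|{\bf h}_k\|^2+|{\bf h}_k^T{\bf h}_i^*|^2)}$$ be the SINR of user $k$ for the common message, and let $\bar R_k^{(c)}=\mathbb E\{\log_2(1+\gamma_k^{(c)})\}$ be its ergodic rate (for $k\le K$ the rate is integrable). For distinct $k,i,j$ put $D_k=\mathbb E\{\|{\bf h}_k\|^4\}$, $E_{k,i}=\mathbb E\{|{\bf h}_k^T{\bf h}_i^*|^2\}$, $F_{i,k}=\mathbb E\{{\bf h}_i^T{\bf h}_k^*\|{\bf h}_k\|^2\}$, $G_{i,k,j}=\mathbb E\{{\bf h}_i^T{\bf h}_k^*{\bf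 h}_k^T{\bf h}_j^*\}$, and $$\tilde R_k^{(c)}=\log_2\left(1+\alpha\rho\,\frac{D_k+\sum_{i\ne k}(2F_{i,k}+E_{k,i})+\sum_{i\ne k}\sum_{j\ne k,i}G_{i,k,j}+NA_k\sum_{i=1}^K\sigma_{e_i}^2}{\sigma_k^2+\alpha\bar\rho\,(D_k+NA_k\sum_{i=1}^K\sigma_{e_i}^2+\sum_{i\ne k}E_{k,i})}\right),$$ where all indices run over $1,\dots,K$. Then $\tilde R_k^{(c)}-\bar R_k^{(c)}\to0$ as $N\to\infty$ and $K\to\infty$ jointly (with no relation imposed between $N$ and $K$). Moreover the approximation is explicit: with $A_i=2b_i+\Omega_i$, $B_i=2b_i+\sigma_{e_i}^2+\Omega_i$ and $C_i=\frac{\Gamma(m_i+1/2)}{\Gamma(m_i)}\sqrt{\Omega_i/m_i}$, which are respectively the second absolute moment of an entry of ${\bf h}_i$, the second absolute moment of an entry of $\hat{\bf h}_i$ and the mean of an entry of $\hat{\bf h}_i$, for all $N,K$ and all distinct $k,i,j$, $$\alpha=\frac{P_t}{N\sum_{i=1}^KB_i+\rho N\sum_{i=1}^K\sum_{j\ne i}C_iC_j},\qquad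 D_k=N\Big(4b_k^2+4b_k\Omega_k+\frac{\Omega_k^2}{m_k}\Big)+N^2A_k^2,$$ $$E_{k,i}=NA_kA_i+N(N-1)C_k^2C_i^2,\qquad G_{i,k,j}=NC_iC_j\big(A_k+(N-1)C_k^2\big),$$ $$F_{i,k}=NC_i\Big(\frac{\Gamma(m_k+3/2)}{\Gamma(m_k)}\Big(\frac{\Omega_k}{m_k}\Big)^{3/2}+4b_kC_k+C_k(N-1)A_k\Big).$$ -/

import Mathlib

open MeasureTheory ProbabilityTheory Filter Topology
open scoped BigOperators Matrix

noncomputable section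

namespace RSMA

/-- The Nakagami distribution with shape parameter `m` and spread parameter `Ω`. -/
def nakagami (m Ω : ℝ) : Measure ℝ :=
  volume.withDensity fun x => ENNReal.ofReal
    (if 0 < x then
      2 * m ^ m / (Real.Gamma m * Ω ^ m) * x ^ (2 * m - 1) * Real.exp (-(m / Ω) * x ^ 2)
    else 0)

/-- The circularly symmetric complex normal distribution `CN(0, v)`: independent real and
imaginary parts, each centred normal with variance `v / 2`. -/
def complexNormal (v : ℝ) : Measure ℂ :=
  ((gaussianReal 0 (v / 2).toNNReal).prod (gaussianReal 0 (v / 2).toNNReal)).map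
    fun p => (⟨p.1, p.2⟩ : ℂ)

/-- The Shadowed-Rician distribution `SR(m, Ω, b)`: the law of the sum of a line-of-sight component
with law `Nakagami(m, Ω)` and an independent scatter component with law `CN(0, 2b)`. -/
def shadowedRician (m Ω b : ℝ) : Measure ℂ :=
  ((nakagami m Ω).prod (complexNormal (2 * b))).map fun p => (p.1 : ℂ) + p.2

/-- Numerical parameters of the system. Users are numbered `0, 1, 2, …`; the system with `K` users
consists of the users `0, …, K - 1`. -/
structure Params where
  /-- Nakagami shape parameters of the users -/
  m : ℕ → ℝ
  /-- Nakagami spread parameters of the users -/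
  Ω : ℕ → ℝ
  /-- half of the power of the scatter components -/
  b : ℕ → ℝ
  /-- channel estimation error variances -/
  errVar : ℕ → ℝ
  /-- receiver noise variances -/
  noiseVar : ℕ → ℝ
  /-- average transmit power constraint -/
  Pt : ℝ
  /-- power splitting factor between common and private messages -/
  ρ : ℝ

/-- `h i t` is the true channel from antenna `t` to user `i` and `e i t` is the error in its
estimate. All the channel coefficients and all the errors are mutually independent, with the
Shadowed-Rician and the complex normal law. -/
structure IsChannelModel {S : Type*} [MeasurableSpace S] (p : Params) (μ : Measure S)
    (h e : ℕ → ℕ → S → ℂ) : Prop where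
  measurable_channel : ∀ i t, Measurable (h i t)
  measurable_error : ∀ i t, Measurable (e i t)
  law_channel : ∀ i t, μ.map (h i t) = shadowedRician (p.m i) (p.Ω i) (p.b i)
  law_error : ∀ i t, μ.map (e i t) = complexNormal (p.errVar i)
  indep : iIndepFun (fun (a : ℕ × ℕ) (s : S) => (h a.1 a.2 s, e a.1 a.2 s)) μ
  indep_error : ∀ i t, IndepFun (h i t) (e i t) μ

/-- `A_i = 2 b_i + Ω_i`, the power of a channel coefficient of user `i`. -/
def A (p : Params) (i : ℕ) : ℝ := 2 * p.b i + p.Ω i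

/-- `B_i = 2 b_i + σ_{e_i}^2 + Ω_i`, the power of an estimated channel coefficient of user `i`. -/
def B (p : Params) (i : ℕ) : ℝ := 2 * p.b i + p.errVar i + p.Ω i

/-- `C_i`, the mean of a channel coefficient of user `i`. -/
def C (p : Params) (i : ℕ) : ℝ :=
  Real.Gamma (p.m i + 1 / 2) / Real.Gamma (p.m i) * Real.sqrt (p.Ω i / p.m i)

section

variable {S : Type*} [MeasurableSpace S] (p : Params) (μ : Measure S) (h e : ℕ → ℕ → S → ℂ)

/-- The vector `g_i ∈ ℂ^N` of the first `N` coefficients of user `i`, for `g = h` or `g = e`. -/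
def vec (g : ℕ → ℕ → S → ℂ) (N i : ℕ) (s : S) : Fin N → ℂ := fun t => g i t s

/-- The squared Euclidean norm of a complex vector. -/
def sqNorm {N : ℕ} (v : Fin N → ℂ) : ℝ := ∑ t, ‖v t‖ ^ 2

/-- `u^T v^*`. -/
def herm {N : ℕ} (u v : Fin N → ℂ) : ℂ := u ⬝ᵥ star v

/-- The estimated channel vector, true channel plus error. -/
def est (N i : ℕ) (s : S) : Fin N → ℂ := vec h N i s + vec e N i s

/-- The precoding matrix `[w_c, w_1, …, w_K]`: maximum ratio transmission for the common message,
in column `0`, and matched filtering for the private messages, in the other columns. -/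
def precoder (N K : ℕ) (s : S) : Matrix (Fin N) (Fin (K + 1)) ℂ :=
  Matrix.of fun t c =>
    (Fin.cons (∑ i : Fin K, star (est h e N i s)) (fun i : Fin K => star (est h e N i s)) :
      Fin (K + 1) → Fin N → ℂ) c t

/-- The power splitting matrix `Diag(√ρ, √(1 - ρ), …, √(1 - ρ))`. -/
def splitting (K : ℕ) : Matrix (Fin (K + 1)) (Fin (K + 1)) ℂ :=
  Matrix.diagonal
    (Fin.cons ((Real.sqrt p.ρ : ℝ) : ℂ) fun _ : Fin K => ((Real.sqrt (1 - p.ρ) : ℝ) : ℂ))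

/-- The power normalization factor `α = P_t / E[Tr(Wᴴ W P²)]`. -/
def alpha (N K : ℕ) : ℝ :=
  p.Pt / ∫ s, (Matrix.trace
    ((precoder h e N K s)ᴴ * precoder h e N K s * splitting p K ^ 2)).re ∂μ

/-- The SINR of user `k` for decoding the common message, with `N` antennas and `K` users. -/
def sinr (N K k : ℕ) (s : S) : ℝ :=
  (alpha p μ h e N K * p.ρ *
      ‖herm (vec h N k s) (∑ i ∈ Finset.range K, vec h N i s)‖ ^ 2
    + alpha p μ h e N K * p.ρ *
      ∑ i ∈ Finset.range K, p.errVar i * sqNorm (vec h N k s)) /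
  (p.noiseVar k + alpha p μ h e N K * (1 - p.ρ) *
    ∑ i ∈ Finset.range K,
      (p.errVar i * sqNorm (vec h N k s) + ‖herm (vec h N k s) (vec h N i s)‖ ^ 2))

/-- The instantaneous rate `R_k^{(c)}` at which user `k` can decode the common message. -/
def rate (N K k : ℕ) (s : S) : ℝ := Real.logb 2 (1 + sinr p μ h e N K k s)

/-- The ergodic rate of user `k` for decoding the common message. -/
def ergodicRate (N K k : ℕ) : ℝ := ∫ s, rate p μ h e N K k s ∂μ

/-- `D_k = E ‖h_k‖^4`. -/
def D (N k : ℕ) : ℝ := ∫ s, sqNorm (vec h N k s) ^ 2 ∂μ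

/-- `E_{k,i} = E |h_k^T h_i^*|^2`. -/
def E (N k i : ℕ) : ℝ := ∫ s, ‖herm (vec h N k s) (vec h N i s)‖ ^ 2 ∂μ

/-- `F_{i,k} = E (h_i^T h_k^* ‖h_k‖^2)`. -/
def F (N i k : ℕ) : ℂ :=
  ∫ s, herm (vec h N i s) (vec h N k s) * (sqNorm (vec h N k s) : ℂ) ∂μ

/-- `G_{i,k,j} = E (h_i^T h_k^* h_k^T h_j^*)`. -/
def G (N i k j : ℕ) : ℂ :=
  ∫ s, herm (vec h N i s) (vec h N k s) * herm (vec h N k s) (vec h N j s) ∂μ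

/-- The approximate ergodic rate of user `k` for decoding the common message. -/
def approxRate (N K k : ℕ) : ℝ :=
  Real.logb 2 (1 + alpha p μ h e N K * p.ρ *
    ((D μ h N k
      + ∑ i ∈ (Finset.range K).erase k, (2 * (F μ h N i k).re + E μ h N k i)
      + ∑ i ∈ (Finset.range K).erase k, ∑ j ∈ ((Finset.range K).erase k).erase i,
          (G μ h N i k j).re
      + N * A p k * ∑ i ∈ Finset.range K, p.errVar i) /
    (p.noiseVar k + alpha p μ h e N K * (1 - p.ρ) *
      (D μ h N k + (∑ i ∈ Finset.range K, p.errVar i) * N * A p k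
        + ∑ i ∈ (Finset.range K).erase k, E μ h N k i))))

end

end RSMA

end

/-! Write the SINR as X / Y, so that the rate is (log(Y + X) - log Y) / log 2. The approximate rate
is the same expression with the powers Y and Y + X replaced by their means. It therefore suffices
that log W and log E W have asymptotically equal means for W = Y and for W = Y + X, and this is a
concentration statement.

Three facts about W give it (`RelDev.log`): W is bounded below by the noise variance, E W is at most
L N, and E|W - E W| is at most (R / √N) E W. The error is then of order log N / √N. The constants R
and L depend neither on N nor on K (`IsChannelModel.exists_relDev`), so the number of users only has
to exceed k.

For the concentration, each product T_i of the channel of user k with that of user i has mean of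
order N C_i and variance O(N C_i^2). The second claim rests on A_i ≤ M C_i^2 with M uniform in i
(`exists_A_le_mul_C_sq`), which follows from log-convexity of Γ and the bounds on m_i and b_i / Ω_i.
The T_i are dependent, but weighted Cauchy-Schwarz shows that their sum satisfies the same estimate
with C_i replaced by ∑ C_i (`MeanVarBound.sum`). Small relative variance makes |T|^2 concentrate
(`relDev_norm_sq`), and relative mean deviation survives nonnegative combinations (`RelDev.add`).

The linear growth of the means comes from the normalization: α N times the precoder power per
antenna is at most P_t, and that power dominates both ∑ B_i and ρ (∑ C_i)^2.

The explicit formulas are moment computations: polynomial moments of one entry reduce to Nakagami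
and Gaussian moments, and joint moments of vectors are double sums over antennas, split into equal
and distinct indices (`integral_double_sum`). -/

namespace RSMA

/-! ### Moments of the Nakagami and the real Gaussian law. -/

lemma measurable_nakagami_density (m Ω : ℝ) : Measurable fun x : ℝ =>
    (if 0 < x then
      2 * m ^ m / (Real.Gamma m * Ω ^ m) * x ^ (2 * m - 1) * Real.exp (-(m / Ω) * x ^ 2)
    else 0) := by
  refine Measurable.ite measurableSet_Ioi ?_ measurable_const
  fun_prop

lemma nakagami_density_nonneg {m Ω : ℝ} (hm : 0 < m) (hΩ : 0 < Ω) (x : ℝ) :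
    0 ≤ (if 0 < x then
      2 * m ^ m / (Real.Gamma m * Ω ^ m) * x ^ (2 * m - 1) * Real.exp (-(m / Ω) * x ^ 2)
    else 0) := by
  split_ifs with hx
  · have := Real.Gamma_pos_of_pos hm
    positivity
  · exact le_rfl

lemma nakagami_density_mul_pow {m Ω : ℝ} (n : ℕ) :
    (fun x : ℝ => (if 0 < x then
      2 * m ^ m / (Real.Gamma m * Ω ^ m) * x ^ (2 * m - 1) * Real.exp (-(m / Ω) * x ^ 2)
    else 0) * x ^ n) = (Set.Ioi (0 : ℝ)).indicator fun x =>
      2 * m ^ m / (Real.Gamma m * Ω ^ m) *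
        (x ^ (2 * m - 1 + n) * Real.exp (-(m / Ω) * x ^ (2 : ℝ))) := by
  ext x
  by_cases hx : 0 < x
  · simp only [hx, if_true, Set.indicator, Set.mem_Ioi]
    rw [Real.rpow_add hx, Real.rpow_natCast, Real.rpow_two]
    ring
  · simp [hx, Set.indicator]

lemma integrable_pow_nakagami {m Ω : ℝ} (hm : 0 < m) (hΩ : 0 < Ω) (n : ℕ) :
    Integrable (fun x => x ^ n) (nakagami m Ω) := by
  unfold nakagami
  rw [integrable_withDensity_iff_integrable_smul' (measurable_nakagami_density m Ω).ennreal_ofReal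
    (by simp)]
  simp only [ENNReal.toReal_ofReal (nakagami_density_nonneg hm hΩ _), smul_eq_mul]
  rw [nakagami_density_mul_pow, integrable_indicator_iff measurableSet_Ioi]
  have hn : (0 : ℝ) ≤ n := n.cast_nonneg
  exact (integrableOn_rpow_mul_exp_neg_mul_rpow (by linarith) two_pos (by positivity)).const_mul _

lemma integral_pow_nakagami {m Ω : ℝ} (hm : 0 < m) (hΩ : 0 < Ω) (n : ℕ) :
    ∫ x, x ^ n ∂nakagami m Ω =
      Real.Gamma (m + n / 2) / Real.Gamma m * (Ω / m) ^ ((n : ℝ) / 2) := by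
  unfold nakagami
  rw [integral_withDensity_eq_integral_toReal_smul
    (measurable_nakagami_density m Ω).ennreal_ofReal (by simp)]
  simp only [ENNReal.toReal_ofReal (nakagami_density_nonneg hm hΩ _), smul_eq_mul]
  have hn : (0 : ℝ) ≤ n := n.cast_nonneg
  rw [nakagami_density_mul_pow, integral_indicator measurableSet_Ioi, integral_const_mul,
    integral_rpow_mul_exp_neg_mul_rpow two_pos (by linarith) (by positivity)]
  have hG := Real.Gamma_pos_of_pos hm
  have h1 : (2 * m - 1 + n + 1) / 2 = m + n / 2 := by ring
  have h2 : -(2 * m - 1 + n + 1) / 2 = -(m + n / 2) := by ring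
  rw [h1, h2, Real.rpow_neg (by positivity), Real.rpow_add (by positivity), mul_inv,
    Real.div_rpow hm.le hΩ.le, ← Real.inv_rpow (by positivity) ((n : ℝ) / 2), inv_div]
  field_simp

/-- The zeroth moment carries everything: its integrability gives finiteness, its value the total
mass. -/
lemma isProbabilityMeasure_nakagami {m Ω : ℝ} (hm : 0 < m) (hΩ : 0 < Ω) :
    IsProbabilityMeasure (nakagami m Ω) := by
  have hi := integrable_pow_nakagami hm hΩ 0
  have h := integral_pow_nakagami hm hΩ 0
  simp only [pow_zero] at hi
  have hf : IsFiniteMeasure (nakagami m Ω) := by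
    simpa [integrable_const_iff] using hi
  have hG := Real.Gamma_pos_of_pos hm
  simp only [pow_zero, integral_const, smul_eq_mul, mul_one, Nat.cast_zero, zero_div, add_zero,
    Real.rpow_zero, div_self hG.ne'] at h
  refine ⟨?_⟩
  rw [Measure.real, ENNReal.toReal_eq_one_iff] at h
  exact h

lemma integrable_pow_gaussianReal (v : NNReal) (n : ℕ) :
    Integrable (fun x => x ^ n) (gaussianReal 0 v) := by
  have h := (memLp_id_gaussianReal (μ := 0) (v := v) (n : NNReal)).integrable_norm_pow'
  refine h.congr' (by fun_prop) (Eventually.of_forall fun x => ?_)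
  simp

lemma integral_odd_pow_gaussianReal (v : NNReal) {n : ℕ} (hn : Odd n) :
    ∫ x, x ^ n ∂gaussianReal 0 v = 0 := by
  have h : ∫ x, x ^ n ∂gaussianReal 0 v = ∫ x, (-x) ^ n ∂gaussianReal 0 v := by
    conv_lhs => rw [← neg_zero, ← gaussianReal_map_neg]
    rw [integral_map (by fun_prop) (by fun_prop)]
  simp only [hn.neg_pow, integral_neg] at h
  linarith

lemma integral_sq_gaussianReal (v : NNReal) : ∫ x, x ^ 2 ∂gaussianReal 0 v = v := by
  have h := variance_fun_id_gaussianReal (μ := 0) (v := v)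
  rw [variance_eq_integral (by fun_prop)] at h
  simpa using h

/-- Evenness folds the integral onto the half-line, where it is a Gamma integral with Γ(5/2) =
(3/4)√π. The degenerate variance has no density and is treated apart. -/
lemma integral_pow_four_gaussianReal (v : NNReal) :
    ∫ x, x ^ 4 ∂gaussianReal 0 v = 3 * (v : ℝ) ^ 2 := by
  rcases eq_or_ne v 0 with rfl | hv
  · simp
  have hv' : (0 : ℝ) < v := by positivity
  rw [integral_gaussianReal_eq_integral_smul hv]
  have h1 : (fun x : ℝ => gaussianPDFReal 0 v x • x ^ 4) = fun x : ℝ =>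
      (fun y : ℝ => (Real.sqrt (2 * Real.pi * v))⁻¹ *
        (y ^ 4 * Real.exp (-(2 * (v : ℝ))⁻¹ * y ^ 2))) |x| := by
    ext x
    simp only [gaussianPDFReal, smul_eq_mul, sub_zero, sq_abs, Even.pow_abs (by decide : Even 4)]
    rw [show -x ^ 2 / (2 * (v : ℝ)) = -(2 * (v : ℝ))⁻¹ * x ^ 2 by field_simp]
    ring
  rw [h1, integral_comp_abs (f := fun y : ℝ => (Real.sqrt (2 * Real.pi * v))⁻¹ *
        (y ^ 4 * Real.exp (-(2 * (v : ℝ))⁻¹ * y ^ 2)))]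
  have h2 := integral_rpow_mul_exp_neg_mul_rpow (p := 2) (q := 4) (b := (2 * (v : ℝ))⁻¹)
    two_pos (by norm_num) (by positivity)
  have h3 : Real.Gamma ((4 + 1) / 2) = 3 / 4 * Real.sqrt Real.pi := by
    rw [show ((4 : ℝ) + 1) / 2 = (1 / 2 + 1) + 1 by norm_num, Real.Gamma_add_one (by norm_num),
      Real.Gamma_add_one (by norm_num), Real.Gamma_one_half_eq]
    ring
  have h4 : ((2 * (v : ℝ))⁻¹) ^ (-(4 + 1) / 2 : ℝ) = (2 * (v : ℝ)) ^ 2 * Real.sqrt (2 * v) := by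
    rw [Real.inv_rpow (by positivity), ← Real.rpow_neg (by positivity), Real.sqrt_eq_rpow,
      ← Real.rpow_two, ← Real.rpow_add (by positivity)]
    norm_num
  rw [h3, h4] at h2
  have h5 : Real.sqrt (2 * Real.pi * v) = Real.sqrt (2 * v) * Real.sqrt Real.pi := by
    rw [← Real.sqrt_mul (by positivity)]
    ring_nf
  rw [integral_const_mul, h5]
  norm_cast at h2 ⊢
  rw [h2]
  have := Real.pi_pos
  push_cast
  have hs1 : Real.sqrt (2 * v) ≠ 0 := by positivity
  have hs2 : Real.sqrt Real.pi ≠ 0 := by positivity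
  field_simp
  ring

end RSMA

/-! ### Moments of the Shadowed-Rician and the complex normal law. -/

namespace RSMA

/-- A list entry encodes a coefficient and the exponents of the three variables. With this encoding,
Fubini and linearity are used once, and each later moment only needs its polynomial expansion. -/
lemma integrable_and_integral_monomial_sum {ν γ₁ γ₂ : Measure ℝ} [SFinite ν] [SFinite γ₁]
    [SFinite γ₂] (hν : ∀ n : ℕ, Integrable (fun x => x ^ n) ν)
    (hγ₁ : ∀ n : ℕ, Integrable (fun x => x ^ n) γ₁) (hγ₂ : ∀ n : ℕ, Integrable (fun x => x ^ n) γ₂)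
    (l : List (ℝ × ℕ × ℕ × ℕ)) :
    Integrable (fun q : ℝ × ℝ × ℝ => (l.map fun c =>
      c.1 * (q.1 ^ c.2.1 * (q.2.1 ^ c.2.2.1 * q.2.2 ^ c.2.2.2))).sum) (ν.prod (γ₁.prod γ₂)) ∧
    ∫ q : ℝ × ℝ × ℝ, (l.map fun c =>
      c.1 * (q.1 ^ c.2.1 * (q.2.1 ^ c.2.2.1 * q.2.2 ^ c.2.2.2))).sum ∂(ν.prod (γ₁.prod γ₂)) =
    (l.map fun c => c.1 * ((∫ x, x ^ c.2.1 ∂ν) * ((∫ x, x ^ c.2.2.1 ∂γ₁) *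
      ∫ x, x ^ c.2.2.2 ∂γ₂))).sum := by
  induction l with
  | nil => simp
  | cons c l ih =>
    obtain ⟨a, i, j, k⟩ := c
    simp only [List.map_cons, List.sum_cons]
    have h1 : Integrable (fun q : ℝ × ℝ × ℝ => a * (q.1 ^ i * (q.2.1 ^ j * q.2.2 ^ k)))
        (ν.prod (γ₁.prod γ₂)) :=
      ((hν i).mul_prod ((hγ₁ j).mul_prod (hγ₂ k))).const_mul a
    refine ⟨h1.add ih.1, ?_⟩
    rw [integral_add h1 ih.1, ih.2, integral_const_mul,
      integral_prod_mul (fun x : ℝ => x ^ i) (fun y : ℝ × ℝ => y.1 ^ j * y.2 ^ k),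
      integral_prod_mul (fun x : ℝ => x ^ j) (fun x : ℝ => x ^ k)]

/-- The shadowed-Rician law as the image of three independent real variables. -/
lemma shadowedRician_eq_map {m Ω b : ℝ} (hm : 0 < m) (hΩ : 0 < Ω) :
    shadowedRician m Ω b = ((nakagami m Ω).prod ((gaussianReal 0 b.toNNReal).prod
      (gaussianReal 0 b.toNNReal))).map
        fun q : ℝ × ℝ × ℝ => ((q.1 + q.2.1 : ℝ) : ℂ) + ((q.2.2 : ℝ) : ℂ) * Complex.I := by
  have := isProbabilityMeasure_nakagami hm hΩ
  have hmk : Measurable fun p : ℝ × ℝ => (⟨p.1, p.2⟩ : ℂ) :=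
    Complex.measurableEquivRealProd.symm.measurable
  unfold shadowedRician complexNormal
  rw [mul_div_cancel_left₀ b two_ne_zero]
  conv_lhs => rw [← Measure.map_id (μ := nakagami m Ω)]
  rw [Measure.map_prod_map _ _ measurable_id hmk, Measure.map_map (by fun_prop) (by fun_prop)]
  congr 1
  ext q
  simp [Complex.ext_iff]

lemma normSq_add_mul_I (x y : ℝ) : ‖(x : ℂ) + (y : ℂ) * Complex.I‖ ^ 2 = x ^ 2 + y ^ 2 := by
  rw [Complex.sq_norm, Complex.normSq_add_mul_I]

/-- Moments of the shadowed-Rician law that are polynomial in the three underlying variables. -/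
lemma polynomial_moment_shadowedRician {m Ω b : ℝ} (hm : 0 < m) (hΩ : 0 < Ω) {f : ℂ → ℝ}
    (hf : Continuous f) (l : List (ℝ × ℕ × ℕ × ℕ))
    (hl : ∀ z x y : ℝ, f (((z + x : ℝ) : ℂ) + (y : ℂ) * Complex.I) =
      (l.map fun c => c.1 * (z ^ c.2.1 * (x ^ c.2.2.1 * y ^ c.2.2.2))).sum) :
    Integrable f (shadowedRician m Ω b) ∧ ∫ w, f w ∂shadowedRician m Ω b =
      (l.map fun c => c.1 * ((∫ x, x ^ c.2.1 ∂nakagami m Ω) *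
        ((∫ x, x ^ c.2.2.1 ∂gaussianReal 0 b.toNNReal) *
          ∫ x, x ^ c.2.2.2 ∂gaussianReal 0 b.toNNReal))).sum := by
  have := isProbabilityMeasure_nakagami hm hΩ
  obtain ⟨h1, h2⟩ := integrable_and_integral_monomial_sum (integrable_pow_nakagami hm hΩ)
    (integrable_pow_gaussianReal b.toNNReal) (integrable_pow_gaussianReal b.toNNReal) l
  rw [shadowedRician_eq_map hm hΩ, integrable_map_measure hf.aestronglyMeasurable (by fun_prop),
    integral_map (by fun_prop) hf.aestronglyMeasurable, ← h2]
  simp only [Function.comp_def, hl]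
  exact ⟨h1, trivial⟩

lemma integral_nakagami_pow_zero {m Ω : ℝ} (hm : 0 < m) (hΩ : 0 < Ω) :
    ∫ x, x ^ 0 ∂nakagami m Ω = 1 := by
  have := isProbabilityMeasure_nakagami hm hΩ
  simp

lemma integral_nakagami_pow_one {m Ω : ℝ} (hm : 0 < m) (hΩ : 0 < Ω) :
    ∫ x, x ^ 1 ∂nakagami m Ω = Real.Gamma (m + 1 / 2) / Real.Gamma m * Real.sqrt (Ω / m) := by
  rw [integral_pow_nakagami hm hΩ, Real.sqrt_eq_rpow]
  norm_num

lemma integral_nakagami_pow_two {m Ω : ℝ} (hm : 0 < m) (hΩ : 0 < Ω) :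
    ∫ x, x ^ 2 ∂nakagami m Ω = Ω := by
  have hG := Real.Gamma_pos_of_pos hm
  rw [integral_pow_nakagami hm hΩ]
  norm_num
  rw [Real.Gamma_add_one hm.ne']
  field_simp

lemma integral_nakagami_pow_four {m Ω : ℝ} (hm : 0 < m) (hΩ : 0 < Ω) :
    ∫ x, x ^ 4 ∂nakagami m Ω = Ω ^ 2 + Ω ^ 2 / m := by
  have hG := Real.Gamma_pos_of_pos hm
  rw [integral_pow_nakagami hm hΩ]
  norm_num
  rw [show m + 2 = (m + 1) + 1 by ring, Real.Gamma_add_one (by positivity),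
    Real.Gamma_add_one hm.ne']
  field_simp

section Moments

variable {m Ω b : ℝ}

lemma integral_normSq_shadowedRician (hm : 0 < m) (hΩ : 0 < Ω) (hb : 0 ≤ b) :
    Integrable (fun w : ℂ => ‖w‖ ^ 2) (shadowedRician m Ω b) ∧
      ∫ w, ‖w‖ ^ 2 ∂shadowedRician m Ω b = 2 * b + Ω := by
  obtain ⟨h1, h2⟩ := polynomial_moment_shadowedRician (b := b) hm hΩ
    (f := fun w => ‖w‖ ^ 2) (by fun_prop)
    [(1, 2, 0, 0), (2, 1, 1, 0), (1, 0, 2, 0), (1, 0, 0, 2)]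
    (fun z x y => by rw [normSq_add_mul_I]; simp; ring)
  refine ⟨h1, h2.trans ?_⟩
  simp only [List.map_cons, List.map_nil, List.sum_cons, List.sum_nil,
    integral_nakagami_pow_zero hm hΩ, integral_nakagami_pow_two hm hΩ, integral_sq_gaussianReal,
    integral_odd_pow_gaussianReal _ odd_one, Real.coe_toNNReal b hb]
  simp
  ring

lemma integral_norm_pow_four_shadowedRician (hm : 0 < m) (hΩ : 0 < Ω) (hb : 0 ≤ b) :
    Integrable (fun w : ℂ => ‖w‖ ^ 4) (shadowedRician m Ω b) ∧
      ∫ w, ‖w‖ ^ 4 ∂shadowedRician m Ω b =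
        (4 * b ^ 2 + 4 * b * Ω + Ω ^ 2 / m) + (2 * b + Ω) ^ 2 := by
  obtain ⟨h1, h2⟩ := polynomial_moment_shadowedRician (b := b) hm hΩ
    (f := fun w => ‖w‖ ^ 4) (by fun_prop)
    -- The monomials of ((z + x)^2 + y^2)^2. Those of odd degree in x integrate to zero.
    [(1, 4, 0, 0), (6, 2, 2, 0), (1, 0, 4, 0), (1, 0, 0, 4), (4, 3, 1, 0), (2, 2, 0, 2),
      (4, 1, 3, 0), (4, 1, 1, 2), (2, 0, 2, 2)]
    (fun z x y => by
      rw [show ∀ a : ℝ, a ^ 4 = (a ^ 2) ^ 2 by intro a; ring, normSq_add_mul_I]; simp; ring)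
  refine ⟨h1, h2.trans ?_⟩
  simp only [List.map_cons, List.map_nil, List.sum_cons, List.sum_nil,
    integral_nakagami_pow_zero hm hΩ, integral_nakagami_pow_two hm hΩ,
    integral_nakagami_pow_four hm hΩ, integral_sq_gaussianReal, integral_pow_four_gaussianReal,
    integral_odd_pow_gaussianReal _ odd_one,
    integral_odd_pow_gaussianReal _ (by decide : Odd 3), Real.coe_toNNReal b hb]
  simp
  ring

lemma integrable_and_integral_of_re_im {α : Type*} [MeasurableSpace α] {ν : Measure α} {f : α → ℂ}
    {r : ℝ} (hre : Integrable (fun x => (f x).re) ν ∧ ∫ x, (f x).re ∂ν = r)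
    (him : Integrable (fun x => (f x).im) ν ∧ ∫ x, (f x).im ∂ν = 0) :
    Integrable f ν ∧ ∫ x, f x ∂ν = r := by
  have hf : f = fun x => ((f x).re : ℂ) + ((f x).im : ℂ) * Complex.I := by
    ext x; simp
  rw [hf]
  refine ⟨hre.1.ofReal.add (him.1.ofReal.mul_const _), ?_⟩
  rw [integral_add hre.1.ofReal (him.1.ofReal.mul_const _), integral_mul_const,
    integral_complex_ofReal, integral_complex_ofReal, hre.2, him.2]
  simp

lemma integral_id_shadowedRician (hm : 0 < m) (hΩ : 0 < Ω) :
    Integrable (fun w : ℂ => w) (shadowedRician m Ω b) ∧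
      ∫ w, w ∂shadowedRician m Ω b =
        ((Real.Gamma (m + 1 / 2) / Real.Gamma m * Real.sqrt (Ω / m) : ℝ) : ℂ) := by
  refine integrable_and_integral_of_re_im ?_ ?_
  · obtain ⟨h1, h2⟩ := polynomial_moment_shadowedRician (b := b) hm hΩ
      (f := fun w => w.re) Complex.continuous_re
      [(1, 1, 0, 0), (1, 0, 1, 0)] (fun z x y => by simp)
    refine ⟨h1, h2.trans ?_⟩
    simp only [List.map_cons, List.map_nil, List.sum_cons, List.sum_nil,
      integral_nakagami_pow_zero hm hΩ, integral_nakagami_pow_one hm hΩ,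
      integral_odd_pow_gaussianReal _ odd_one]
    simp
  · obtain ⟨h1, h2⟩ := polynomial_moment_shadowedRician (b := b) hm hΩ
      (f := fun w => w.im) Complex.continuous_im [(1, 0, 0, 1)] (fun z x y => by simp)
    refine ⟨h1, h2.trans ?_⟩
    simp only [List.map_cons, List.map_nil, List.sum_cons, List.sum_nil,
      integral_odd_pow_gaussianReal _ odd_one]
    simp

/-- For w = z + x + iy, the part of Re(w |w|^2) even in x and y is z^3 + 3zx^2 + zy^2. Both Gaussian
variances are b, whence the factor 3b + b = 4b. The imaginary part is odd in y. -/
lemma integral_mul_normSq_shadowedRician (hm : 0 < m) (hΩ : 0 < Ω) (hb : 0 ≤ b) :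
    Integrable (fun w : ℂ => w * ((‖w‖ ^ 2 : ℝ) : ℂ)) (shadowedRician m Ω b) ∧
      ∫ w : ℂ, w * ((‖w‖ ^ 2 : ℝ) : ℂ) ∂shadowedRician m Ω b =
        ((Real.Gamma (m + 3 / 2) / Real.Gamma m * (Ω / m) ^ (3 / 2 : ℝ)
          + 4 * b * (Real.Gamma (m + 1 / 2) / Real.Gamma m * Real.sqrt (Ω / m)) : ℝ) : ℂ) := by
  refine integrable_and_integral_of_re_im ?_ ?_
  · obtain ⟨h1, h2⟩ := polynomial_moment_shadowedRician (b := b) hm hΩ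
      (f := fun w => (w * ((‖w‖ ^ 2 : ℝ) : ℂ)).re)
      (Complex.continuous_re.comp (by fun_prop))
      [(1, 3, 0, 0), (3, 2, 1, 0), (3, 1, 2, 0), (1, 0, 3, 0), (1, 1, 0, 2), (1, 0, 1, 2)]
      (fun z x y => by rw [Complex.re_mul_ofReal, normSq_add_mul_I]; simp; ring)
    refine ⟨h1, h2.trans ?_⟩
    simp only [List.map_cons, List.map_nil, List.sum_cons, List.sum_nil,
      integral_nakagami_pow_zero hm hΩ, integral_nakagami_pow_one hm hΩ,
      integral_sq_gaussianReal, integral_odd_pow_gaussianReal _ odd_one,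
      integral_odd_pow_gaussianReal _ (by decide : Odd 3), Real.coe_toNNReal b hb,
      integral_pow_nakagami hm hΩ 3]
    simp
    ring
  · obtain ⟨h1, h2⟩ := polynomial_moment_shadowedRician (b := b) hm hΩ
      (f := fun w => (w * ((‖w‖ ^ 2 : ℝ) : ℂ)).im)
      (Complex.continuous_im.comp (by fun_prop))
      [(1, 2, 0, 1), (2, 1, 1, 1), (1, 0, 2, 1), (1, 0, 0, 3)]
      (fun z x y => by rw [Complex.im_mul_ofReal, normSq_add_mul_I]; simp; ring)
    refine ⟨h1, h2.trans ?_⟩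
    simp only [List.map_cons, List.map_nil, List.sum_cons, List.sum_nil,
      integral_odd_pow_gaussianReal _ odd_one,
      integral_odd_pow_gaussianReal _ (by decide : Odd 3)]
    simp

lemma complexNormal_moments {v : ℝ} (hv : 0 ≤ v) :
    (Integrable (fun w : ℂ => w) (complexNormal v) ∧ ∫ w, w ∂complexNormal v = 0) ∧
      Integrable (fun w : ℂ => ‖w‖ ^ 2) (complexNormal v) ∧
        ∫ w, ‖w‖ ^ 2 ∂complexNormal v = v := by
  set γ := gaussianReal 0 (v / 2).toNNReal with hγ
  have hmk : Measurable fun p : ℝ × ℝ => (⟨p.1, p.2⟩ : ℂ) :=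
    Complex.measurableEquivRealProd.symm.measurable
  -- There is no line-of-sight variable here; a dummy one with law `gaussianReal 0 0` makes the
  -- three-variable lemma applicable.
  have key : ∀ f : ℂ → ℝ, Continuous f → ∀ l : List (ℝ × ℕ × ℕ × ℕ),
      (∀ z x y : ℝ, f ⟨x, y⟩ =
        (l.map fun c => c.1 * (z ^ c.2.1 * (x ^ c.2.2.1 * y ^ c.2.2.2))).sum) →
      Integrable f (complexNormal v) ∧ ∫ w, f w ∂complexNormal v =
        (l.map fun c => c.1 * ((∫ x, x ^ c.2.1 ∂gaussianReal 0 0) *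
          ((∫ x, x ^ c.2.2.1 ∂γ) * ∫ x, x ^ c.2.2.2 ∂γ))).sum := by
    intro f hf l hl
    obtain ⟨h1, h2⟩ := integrable_and_integral_monomial_sum (integrable_pow_gaussianReal 0)
      (integrable_pow_gaussianReal (v / 2).toNNReal)
      (integrable_pow_gaussianReal (v / 2).toNNReal) l
    simp only [← hl _ _ _] at h1 h2
    have e : complexNormal v = ((gaussianReal 0 0).prod (γ.prod γ)).map
        fun q : ℝ × ℝ × ℝ => (⟨q.2.1, q.2.2⟩ : ℂ) := by
      unfold complexNormal
      conv_lhs => rw [← hγ, ← Measure.snd_prod (μ := gaussianReal 0 0) (ν := γ.prod γ),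
        Measure.snd, Measure.map_map hmk measurable_snd]
      rfl
    have hmk' : Measurable fun q : ℝ × ℝ × ℝ => (⟨q.2.1, q.2.2⟩ : ℂ) := hmk.comp measurable_snd
    rw [e, integrable_map_measure hf.aestronglyMeasurable hmk'.aemeasurable,
      integral_map hmk'.aemeasurable hf.aestronglyMeasurable, ← h2]
    exact ⟨h1, rfl⟩
  refine ⟨integrable_and_integral_of_re_im (r := 0) ?_ ?_, ?_⟩
  · obtain ⟨h1, h2⟩ := key (fun w => w.re) Complex.continuous_re [(1, 0, 1, 0)] (by simp)
    refine ⟨h1, h2.trans ?_⟩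
    simp [hγ]
  · obtain ⟨h1, h2⟩ := key (fun w => w.im) Complex.continuous_im [(1, 0, 0, 1)] (by simp)
    refine ⟨h1, h2.trans ?_⟩
    simp [hγ]
  · obtain ⟨h1, h2⟩ := key (fun w => ‖w‖ ^ 2) (by fun_prop) [(1, 0, 2, 0), (1, 0, 0, 2)]
      (fun z x y => by rw [Complex.sq_norm, Complex.normSq_mk]; simp; ring)
    refine ⟨h1, h2.trans ?_⟩
    simp only [List.map_cons, List.map_nil, List.sum_cons, List.sum_nil, hγ,
      integral_sq_gaussianReal, Real.coe_toNNReal _ (div_nonneg hv zero_le_two)]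
    simp

end Moments

end RSMA

/-! ### Independent entries and joint moments of the channel vectors. -/

namespace RSMA

variable {S : Type*} [MeasurableSpace S] {μ : Measure S}

section Independence

variable {𝕜 : Type*} [RCLike 𝕜] {ι : Type*} {X : ι → S → ℂ}

lemma indep_integral_mul_two (hX : iIndepFun X μ) {a b : ι} (hab : a ≠ b)
    {f g : ℂ → 𝕜} (hf : Measurable f) (hg : Measurable g)
    (hfa : Integrable (fun s => f (X a s)) μ) (hgb : Integrable (fun s => g (X b s)) μ) :
    Integrable (fun s => f (X a s) * g (X b s)) μ ∧
      ∫ s, f (X a s) * g (X b s) ∂μ = (∫ s, f (X a s) ∂μ) * ∫ s, g (X b s) ∂μ := by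
  have h := (hX.indepFun hab).comp hf hg
  exact ⟨h.integrable_mul hfa hgb,
    h.integral_mul_eq_mul_integral hfa.aestronglyMeasurable hgb.aestronglyMeasurable⟩

lemma indep_integral_mul_three (hX : iIndepFun X μ) (hmX : ∀ i, Measurable (X i)) {a b c : ι}
    (hab : a ≠ b) (hac : a ≠ c) (hbc : b ≠ c) {f g u : ℂ → 𝕜} (hf : Measurable f)
    (hg : Measurable g) (hu : Measurable u)
    (hfa : Integrable (fun s => f (X a s)) μ) (hgb : Integrable (fun s => g (X b s)) μ)
    (huc : Integrable (fun s => u (X c s)) μ) :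
    Integrable (fun s => f (X a s) * g (X b s) * u (X c s)) μ ∧
      ∫ s, f (X a s) * g (X b s) * u (X c s) ∂μ =
        (∫ s, f (X a s) ∂μ) * (∫ s, g (X b s) ∂μ) * ∫ s, u (X c s) ∂μ := by
  have hm : Measurable fun z : ℂ × ℂ => f z.1 * g z.2 := by fun_prop
  have h := (hX.indepFun_prodMk hmX a b c hac hbc).comp hm hu
  obtain ⟨h1, h2⟩ := indep_integral_mul_two hX hab hf hg hfa hgb
  rw [← h2]
  exact ⟨h.integrable_mul h1 huc,
    h.integral_mul_eq_mul_integral h1.aestronglyMeasurable huc.aestronglyMeasurable⟩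

lemma indep_integral_mul_four (hX : iIndepFun X μ) (hmX : ∀ i, Measurable (X i)) {a b c d : ι}
    (hab : a ≠ b) (hac : a ≠ c) (had : a ≠ d) (hbc : b ≠ c) (hbd : b ≠ d) (hcd : c ≠ d)
    {f g u v : ℂ → 𝕜} (hf : Measurable f) (hg : Measurable g) (hu : Measurable u)
    (hv : Measurable v)
    (hfa : Integrable (fun s => f (X a s)) μ) (hgb : Integrable (fun s => g (X b s)) μ)
    (huc : Integrable (fun s => u (X c s)) μ) (hvd : Integrable (fun s => v (X d s)) μ) :
    Integrable (fun s => (f (X a s) * g (X b s)) * (u (X c s) * v (X d s))) μ ∧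
      ∫ s, (f (X a s) * g (X b s)) * (u (X c s) * v (X d s)) ∂μ =
        ((∫ s, f (X a s) ∂μ) * (∫ s, g (X b s) ∂μ)) *
          ((∫ s, u (X c s) ∂μ) * ∫ s, v (X d s) ∂μ) := by
  have hm : Measurable fun z : ℂ × ℂ => f z.1 * g z.2 := by fun_prop
  have hm' : Measurable fun z : ℂ × ℂ => u z.1 * v z.2 := by fun_prop
  have h := (hX.indepFun_prodMk_prodMk hmX a b c d hac had hbc hbd).comp hm hm'
  obtain ⟨h1, h2⟩ := indep_integral_mul_two hX hab hf hg hfa hgb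
  obtain ⟨h3, h4⟩ := indep_integral_mul_two hX hcd hu hv huc hvd
  rw [← h2, ← h4]
  exact ⟨h.integrable_mul h1 h3,
    h.integral_mul_eq_mul_integral h1.aestronglyMeasurable h3.aestronglyMeasurable⟩

/-- Every fourth-order joint moment below has this shape: there are N terms with equal antennas and
N(N - 1) with distinct ones. -/
lemma integral_double_sum {N : ℕ} {φ : Fin N → Fin N → S → 𝕜} {P Q : 𝕜}
    (h : ∀ t s, Integrable (φ t s) μ ∧ ∫ x, φ t s x ∂μ = if t = s then P else Q) :
    Integrable (fun x => ∑ t, ∑ s, φ t s x) μ ∧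
      ∫ x, ∑ t, ∑ s, φ t s x ∂μ = N * P + N * ((N : 𝕜) - 1) * Q := by
  have hi : ∀ t, Integrable (fun x => ∑ s, φ t s x) μ :=
    fun t => integrable_finsetSum _ fun s _ => (h t s).1
  refine ⟨integrable_finsetSum _ fun t _ => hi t, ?_⟩
  rw [integral_finsetSum _ fun t _ => hi t]
  have : ∀ t, ∫ x, ∑ s, φ t s x ∂μ = P + ((N : 𝕜) - 1) * Q := by
    intro t
    rw [integral_finsetSum _ fun s _ => (h t s).1]
    have e : ∀ s, ∫ x, φ t s x ∂μ = Q + if t = s then P - Q else 0 := by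
      intro s
      rw [(h t s).2]
      split_ifs <;> ring
    simp only [e, Finset.sum_add_distrib, Finset.sum_const, Finset.card_univ, Fintype.card_fin,
      Finset.sum_ite_eq, Finset.mem_univ, if_true, nsmul_eq_mul]
    ring
  simp only [this, Finset.sum_const, Finset.card_univ, Fintype.card_fin, nsmul_eq_mul]
  ring

end Independence

/-- A doubly indexed family of independent complex entries, with the moments of the entries
`h i t` depending only on `i`. -/
structure IndepEntries (μ : Measure S) (h : ℕ → ℕ → S → ℂ) (c a q f : ℕ → ℝ) : Prop where
  measurable : ∀ i t, Measurable (h i t)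
  indep : iIndepFun (fun x : ℕ × ℕ => h x.1 x.2) μ
  integrable : ∀ i t, Integrable (h i t) μ
  mean : ∀ i t, ∫ s, h i t s ∂μ = c i
  integrable_sq : ∀ i t, Integrable (fun s => ‖h i t s‖ ^ 2) μ
  sq : ∀ i t, ∫ s, ‖h i t s‖ ^ 2 ∂μ = a i
  integrable_four : ∀ i t, Integrable (fun s => ‖h i t s‖ ^ 4) μ
  four : ∀ i t, ∫ s, ‖h i t s‖ ^ 4 ∂μ = q i
  integrable_cube : ∀ i t, Integrable (fun s => h i t s * ((‖h i t s‖ ^ 2 : ℝ) : ℂ)) μ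
  cube : ∀ i t, ∫ s, h i t s * ((‖h i t s‖ ^ 2 : ℝ) : ℂ) ∂μ = f i

lemma herm_eq_sum {N : ℕ} (u v : Fin N → ℂ) : herm u v = ∑ t, u t * star (v t) := rfl

lemma star_herm {N : ℕ} (u v : Fin N → ℂ) : star (herm u v) = herm v u := by
  simp [herm_eq_sum, mul_comm]

lemma herm_self {N : ℕ} (u : Fin N → ℂ) : herm u u = (sqNorm u : ℂ) := by
  simp [herm_eq_sum, sqNorm, Complex.mul_conj, Complex.normSq_eq_norm_sq]

lemma norm_herm_sq {N : ℕ} (u v : Fin N → ℂ) :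
    ((‖herm u v‖ ^ 2 : ℝ) : ℂ) = herm u v * herm v u := by
  rw [← star_herm u v, ← Complex.normSq_eq_norm_sq, ← Complex.mul_conj]
  rfl

lemma herm_mul_herm {N : ℕ} (u v w z : Fin N → ℂ) :
    herm u v * herm w z = ∑ t, ∑ s, u t * star (v t) * (w s * star (z s)) := by
  rw [herm_eq_sum, herm_eq_sum, Finset.sum_mul_sum]

namespace IndepEntries

variable {h : ℕ → ℕ → S → ℂ} {c a q f : ℕ → ℝ} (H : IndepEntries μ h c a q f)

include H

lemma integrable_star (i t : ℕ) : Integrable (fun s => star (h i t s)) μ :=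
  (Complex.conjCLE : ℂ →L[ℝ] ℂ).integrable_comp (H.integrable i t)

lemma mean_star (i t : ℕ) : ∫ s, star (h i t s) ∂μ = c i := by
  have := integral_conj (f := h i t) (μ := μ)
  rw [H.mean, Complex.conj_ofReal] at this
  exact this

lemma integrable_sq_complex (i t : ℕ) : Integrable (fun s => ((‖h i t s‖ ^ 2 : ℝ) : ℂ)) μ :=
  (H.integrable_sq i t).ofReal

lemma sq_complex (i t : ℕ) : ∫ s, ((‖h i t s‖ ^ 2 : ℝ) : ℂ) ∂μ = a i := by
  rw [integral_complex_ofReal, H.sq]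

lemma integrable_cube_star (i t : ℕ) :
    Integrable (fun s => star (h i t s) * ((‖h i t s‖ ^ 2 : ℝ) : ℂ)) μ := by
  have := (Complex.conjCLE : ℂ →L[ℝ] ℂ).integrable_comp (H.integrable_cube i t)
  simpa using this

lemma cube_star (i t : ℕ) :
    ∫ s, star (h i t s) * ((‖h i t s‖ ^ 2 : ℝ) : ℂ) ∂μ = f i := by
  have := integral_conj (f := fun s => h i t s * ((‖h i t s‖ ^ 2 : ℝ) : ℂ)) (μ := μ)
  rw [H.cube, Complex.conj_ofReal] at this
  simpa using this

lemma integral_sqNorm (N k : ℕ) :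
    Integrable (fun s => sqNorm (vec h N k s)) μ ∧
      ∫ s, sqNorm (vec h N k s) ∂μ = N * a k := by
  unfold sqNorm vec
  refine ⟨integrable_finsetSum _ fun t _ => H.integrable_sq k t, ?_⟩
  rw [integral_finsetSum _ fun (t : Fin N) _ => H.integrable_sq k t]
  simp [H.sq]

lemma integral_sqNorm_sq (N k : ℕ) :
    Integrable (fun s => sqNorm (vec h N k s) ^ 2) μ ∧
      ∫ s, sqNorm (vec h N k s) ^ 2 ∂μ = N * q k + N * ((N : ℝ) - 1) * a k ^ 2 := by
  have e : ∀ s, sqNorm (vec h N k s) ^ 2 =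
      ∑ t : Fin N, ∑ r : Fin N, ‖h k t s‖ ^ 2 * ‖h k r s‖ ^ 2 := by
    intro s
    rw [pow_two, sqNorm, Finset.sum_mul_sum]
    rfl
  simp only [e]
  refine integral_double_sum fun t r => ?_
  split_ifs with htr
  · subst htr
    simp only [← pow_add]
    exact ⟨H.integrable_four k t, H.four k t⟩
  · have := indep_integral_mul_two H.indep (a := (k, (t : ℕ))) (b := (k, (r : ℕ)))
      (by simpa [Fin.ext_iff] using htr) (f := fun z : ℂ => ‖z‖ ^ 2) (g := fun z : ℂ => ‖z‖ ^ 2)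
      (by fun_prop) (by fun_prop) (H.integrable_sq k t) (H.integrable_sq k r)
    refine ⟨this.1, this.2.trans ?_⟩
    simp only [H.sq]
    ring

lemma integral_herm (N : ℕ) {k i : ℕ} (hik : k ≠ i) :
    Integrable (fun s => herm (vec h N k s) (vec h N i s)) μ ∧
      ∫ s, herm (vec h N k s) (vec h N i s) ∂μ = N * (c k * c i) := by
  have key : ∀ t : ℕ, Integrable (fun s => h k t s * star (h i t s)) μ ∧
      ∫ s, h k t s * star (h i t s) ∂μ = c k * c i := by
    intro t
    have := indep_integral_mul_two H.indep (a := (k, t)) (b := (i, t)) (by simpa using hik)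
      (f := fun z : ℂ => z) (g := fun z : ℂ => star z) (by fun_prop) (by fun_prop)
      (H.integrable k t) (H.integrable_star i t)
    refine ⟨this.1, this.2.trans ?_⟩
    simp only [H.mean, H.mean_star]
  simp only [herm_eq_sum, vec]
  refine ⟨integrable_finsetSum _ fun t _ => (key t).1, ?_⟩
  rw [integral_finsetSum _ fun (t : Fin N) _ => (key t).1]
  simp only [(key _).2]
  simp

/-- On a common antenna the four factors pair up into two squared moduli; on distinct antennas they
are four independent entries and only the means remain. -/
lemma integral_herm_mul_herm_same (N : ℕ) {k i : ℕ} (hik : i ≠ k) :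
    Integrable (fun s => herm (vec h N k s) (vec h N i s) * herm (vec h N i s) (vec h N k s)) μ ∧
      ∫ s, herm (vec h N k s) (vec h N i s) * herm (vec h N i s) (vec h N k s) ∂μ =
        N * (a k * a i) + N * ((N : ℂ) - 1) * (c k ^ 2 * c i ^ 2) := by
  simp only [herm_mul_herm, vec]
  refine integral_double_sum fun t r => ?_
  split_ifs with htr
  · subst htr
    have := indep_integral_mul_two H.indep (a := (k, (t : ℕ))) (b := (i, (t : ℕ)))
      (by simpa using hik.symm)
      (f := fun z : ℂ => ((‖z‖ ^ 2 : ℝ) : ℂ)) (g := fun z : ℂ => ((‖z‖ ^ 2 : ℝ) : ℂ))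
      (by fun_prop) (by fun_prop) (H.integrable_sq_complex k t) (H.integrable_sq_complex i t)
    simp only [H.sq_complex] at this
    have e : ∀ z w : ℂ, z * star w * (w * star z) =
        ((‖z‖ ^ 2 : ℝ) : ℂ) * ((‖w‖ ^ 2 : ℝ) : ℂ) := by
      intro z w
      simp only [← Complex.normSq_eq_norm_sq, ← Complex.mul_conj, RCLike.star_def]
      ring
    simpa only [e] using this
  · have hd : (t : ℕ) ≠ r := by simpa [Fin.ext_iff] using htr
    have := indep_integral_mul_four H.indep (fun x => H.measurable x.1 x.2)
      (a := (k, (t : ℕ))) (b := (i, (t : ℕ))) (c := (i, (r : ℕ))) (d := (k, (r : ℕ)))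
      (by simp [hik.symm]) (by simp [hik.symm]) (by simp [hd]) (by simp [hd]) (by simp [hik])
      (by simp [hik])
      (f := fun z : ℂ => z) (g := fun z : ℂ => star z) (u := fun z : ℂ => z)
      (v := fun z : ℂ => star z) (by fun_prop) (by fun_prop) (by fun_prop) (by fun_prop)
      (H.integrable k t) (H.integrable_star i t) (H.integrable i r) (H.integrable_star k r)
    refine ⟨this.1, this.2.trans ?_⟩
    simp only [H.mean, H.mean_star]
    ring

/-- On a common antenna three factors belong to the same entry of user k, which is where the cubic
moment enters. -/
lemma integral_herm_mul_herm_self (N : ℕ) {k i : ℕ} (hik : i ≠ k) :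
    Integrable (fun s => herm (vec h N i s) (vec h N k s) * herm (vec h N k s) (vec h N k s)) μ ∧
      ∫ s, herm (vec h N i s) (vec h N k s) * herm (vec h N k s) (vec h N k s) ∂μ =
        N * (c i * f k) + N * ((N : ℂ) - 1) * (c i * c k * a k) := by
  have e : ∀ z : ℂ, z * star z = ((‖z‖ ^ 2 : ℝ) : ℂ) := by
    intro z
    rw [← Complex.normSq_eq_norm_sq, ← Complex.mul_conj, RCLike.star_def]
  simp only [herm_mul_herm, vec, e]
  refine integral_double_sum fun t r => ?_
  split_ifs with htr
  · subst htr
    have := indep_integral_mul_two H.indep (a := (i, (t : ℕ))) (b := (k, (t : ℕ)))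
      (by simpa using hik)
      (f := fun z : ℂ => z) (g := fun z : ℂ => star z * ((‖z‖ ^ 2 : ℝ) : ℂ))
      (by fun_prop) (by fun_prop) (H.integrable i t) (H.integrable_cube_star k t)
    simp only [H.mean, H.cube_star, ← mul_assoc] at this
    exact this
  · have hd : (t : ℕ) ≠ r := by simpa [Fin.ext_iff] using htr
    have := indep_integral_mul_three H.indep (fun x => H.measurable x.1 x.2)
      (a := (i, (t : ℕ))) (b := (k, (t : ℕ))) (c := (k, (r : ℕ)))
      (by simp [hik]) (by simp [hik]) (by simp [hd])
      (f := fun z : ℂ => z) (g := fun z : ℂ => star z) (u := fun z : ℂ => ((‖z‖ ^ 2 : ℝ) : ℂ))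
      (by fun_prop) (by fun_prop) (by fun_prop)
      (H.integrable i t) (H.integrable_star k t) (H.integrable_sq_complex k r)
    simp only [H.mean, H.mean_star, H.sq_complex] at this
    exact this

lemma integral_herm_mul_herm_distinct (N : ℕ) {k i j : ℕ} (hik : i ≠ k) (hjk : j ≠ k)
    (hij : i ≠ j) :
    Integrable (fun s => herm (vec h N i s) (vec h N k s) * herm (vec h N k s) (vec h N j s)) μ ∧
      ∫ s, herm (vec h N i s) (vec h N k s) * herm (vec h N k s) (vec h N j s) ∂μ =
        N * (c i * a k * c j) + N * ((N : ℂ) - 1) * (c i * c k * (c k * c j)) := by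
  simp only [herm_mul_herm, vec]
  refine integral_double_sum fun t r => ?_
  split_ifs with htr
  · subst htr
    have := indep_integral_mul_three H.indep (fun x => H.measurable x.1 x.2)
      (a := (i, (t : ℕ))) (b := (k, (t : ℕ))) (c := (j, (t : ℕ)))
      (by simp [hik]) (by simp [hij]) (by simp [hjk.symm])
      (f := fun z : ℂ => z) (g := fun z : ℂ => ((‖z‖ ^ 2 : ℝ) : ℂ)) (u := fun z : ℂ => star z)
      (by fun_prop) (by fun_prop) (by fun_prop)
      (H.integrable i t) (H.integrable_sq_complex k t) (H.integrable_star j t)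
    simp only [H.mean, H.mean_star, H.sq_complex] at this
    have e : ∀ z w v : ℂ, z * star w * (w * star v) = z * ((‖w‖ ^ 2 : ℝ) : ℂ) * star v := by
      intro z w v
      simp only [← Complex.normSq_eq_norm_sq, ← Complex.mul_conj, RCLike.star_def]
      ring
    simpa only [e] using this
  · have hd : (t : ℕ) ≠ r := by simpa [Fin.ext_iff] using htr
    have := indep_integral_mul_four H.indep (fun x => H.measurable x.1 x.2)
      (a := (i, (t : ℕ))) (b := (k, (t : ℕ))) (c := (k, (r : ℕ))) (d := (j, (r : ℕ)))
      (by simp [hik]) (by simp [hik]) (by simp [hd]) (by simp [hd]) (by simp [hd])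
      (by simp [hjk.symm])
      (f := fun z : ℂ => z) (g := fun z : ℂ => star z) (u := fun z : ℂ => z)
      (v := fun z : ℂ => star z) (by fun_prop) (by fun_prop) (by fun_prop) (by fun_prop)
      (H.integrable i t) (H.integrable_star k t) (H.integrable k r) (H.integrable_star j r)
    simp only [H.mean, H.mean_star] at this
    exact this

end IndepEntries

end RSMA

/-! ### The estimated channel and the power normalization. -/

namespace RSMA

variable {S : Type*} [MeasurableSpace S] {μ : Measure S} {p : Params} {h e : ℕ → ℕ → S → ℂ}

/-- The fourth absolute moment of a channel coefficient. -/
noncomputable def fourthMoment (p : Params) (i : ℕ) : ℝ :=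
  (4 * p.b i ^ 2 + 4 * p.b i * p.Ω i + p.Ω i ^ 2 / p.m i) + A p i ^ 2

/-- The moment `E (h |h|^2)` of a channel coefficient. -/
noncomputable def cubicMoment (p : Params) (i : ℕ) : ℝ :=
  Real.Gamma (p.m i + 3 / 2) / Real.Gamma (p.m i) * (p.Ω i / p.m i) ^ (3 / 2 : ℝ)
    + 4 * p.b i * C p i

lemma IsChannelModel.indepEntries (H : IsChannelModel p μ h e) (hm : ∀ i, 0 < p.m i)
    (hΩ : ∀ i, 0 < p.Ω i) (hb : ∀ i, 0 ≤ p.b i) :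
    IndepEntries μ h (C p) (A p) (fourthMoment p) (cubicMoment p) := by
  have tr : ∀ {E : Type} [NormedAddCommGroup E] [NormedSpace ℝ E] [SecondCountableTopology E]
      (f : ℂ → E) (v : E) (i t : ℕ), Continuous f →
      (Integrable f (shadowedRician (p.m i) (p.Ω i) (p.b i)) ∧
        ∫ w, f w ∂shadowedRician (p.m i) (p.Ω i) (p.b i) = v) →
      Integrable (fun s => f (h i t s)) μ ∧ ∫ s, f (h i t s) ∂μ = v := by
    intro E _ _ _ f v i t hf hv
    have hmeas := (H.measurable_channel i t).aemeasurable (μ := μ)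
    rw [← H.law_channel i t, integrable_map_measure hf.aestronglyMeasurable hmeas,
      integral_map hmeas hf.aestronglyMeasurable] at hv
    exact hv
  have h1 := fun i t => tr (fun w : ℂ => w) _ i t continuous_id
    (integral_id_shadowedRician (b := p.b i) (hm i) (hΩ i))
  have h2 := fun i t => tr (fun w : ℂ => ‖w‖ ^ 2) _ i t (by fun_prop)
    (integral_normSq_shadowedRician (hm i) (hΩ i) (hb i))
  have h3 := fun i t => tr (fun w : ℂ => w * ((‖w‖ ^ 2 : ℝ) : ℂ)) _ i t (by fun_prop)
    (integral_mul_normSq_shadowedRician (hm i) (hΩ i) (hb i))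
  have h4 := fun i t => tr (fun w : ℂ => ‖w‖ ^ 4) _ i t (by fun_prop)
    (integral_norm_pow_four_shadowedRician (hm i) (hΩ i) (hb i))
  exact
    { measurable := H.measurable_channel
      indep := H.indep.comp (fun _ z => z.1) fun _ => measurable_fst
      integrable := fun i t => (h1 i t).1
      mean := fun i t => (h1 i t).2
      integrable_sq := fun i t => (h2 i t).1
      sq := fun i t => (h2 i t).2
      integrable_four := fun i t => (h4 i t).1
      four := fun i t => (h4 i t).2
      integrable_cube := fun i t => (h3 i t).1
      cube := fun i t => (h3 i t).2 }

lemma IsChannelModel.error_moments (H : IsChannelModel p μ h e) (herr : ∀ i, 0 ≤ p.errVar i)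
    (i t : ℕ) :
    (Integrable (e i t) μ ∧ ∫ s, e i t s ∂μ = 0) ∧
      Integrable (fun s => ‖e i t s‖ ^ 2) μ ∧ ∫ s, ‖e i t s‖ ^ 2 ∂μ = p.errVar i := by
  have hc := complexNormal_moments (herr i)
  have hmeas := (H.measurable_error i t).aemeasurable (μ := μ)
  rw [← H.law_error i t, integrable_map_measure (by fun_prop) hmeas,
    integral_map hmeas (by fun_prop), integrable_map_measure (by fun_prop) hmeas,
    integral_map hmeas (by fun_prop)] at hc
  exact hc

lemma IsChannelModel.estimate_mean (H : IsChannelModel p μ h e) (hm : ∀ i, 0 < p.m i)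
    (hΩ : ∀ i, 0 < p.Ω i) (hb : ∀ i, 0 ≤ p.b i) (herr : ∀ i, 0 ≤ p.errVar i) (i t : ℕ) :
    Integrable (fun s => h i t s + e i t s) μ ∧ ∫ s, (h i t s + e i t s) ∂μ = C p i := by
  have hE := H.indepEntries hm hΩ hb
  obtain ⟨⟨h1, h2⟩, -⟩ := H.error_moments herr i t
  refine ⟨(hE.integrable i t).add h1, ?_⟩
  rw [integral_add (hE.integrable i t) h1, hE.mean, h2, add_zero]

lemma norm_add_sq_complex (x y : ℂ) :
    ‖x + y‖ ^ 2 = ‖x‖ ^ 2 + ‖y‖ ^ 2 + 2 * (x * star y).re := by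
  simp only [← Complex.normSq_eq_norm_sq, Complex.normSq_add, RCLike.star_def]

/-- The cross term vanishes because the error is centred and independent of the channel. -/
lemma IsChannelModel.estimate_sq (H : IsChannelModel p μ h e) (hm : ∀ i, 0 < p.m i)
    (hΩ : ∀ i, 0 < p.Ω i) (hb : ∀ i, 0 ≤ p.b i) (herr : ∀ i, 0 ≤ p.errVar i) (i t : ℕ) :
    Integrable (fun s => ‖h i t s + e i t s‖ ^ 2) μ ∧
      ∫ s, ‖h i t s + e i t s‖ ^ 2 ∂μ = B p i := by
  have hE := H.indepEntries hm hΩ hb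
  obtain ⟨⟨h1, h2⟩, h3, h4⟩ := H.error_moments herr i t
  have hs : Integrable (fun s => star (e i t s)) μ :=
    (Complex.conjCLE : ℂ →L[ℝ] ℂ).integrable_comp h1
  have hs0 : ∫ s, star (e i t s) ∂μ = 0 := by
    have := integral_conj (f := e i t) (μ := μ)
    rw [h2, map_zero] at this
    exact this
  have hind := (H.indep_error i t).comp measurable_id 
    (continuous_star (R := ℂ)).measurable
  have hi : Integrable (fun s => h i t s * star (e i t s)) μ :=
    hind.integrable_mul (hE.integrable i t) hs
  have hi0 : ∫ s, h i t s * star (e i t s) ∂μ = 0 := by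
    refine (hind.integral_mul_eq_mul_integral (hE.integrable i t).aestronglyMeasurable
      hs.aestronglyMeasurable).trans ?_
    simp only [Function.comp_def, hs0, mul_zero]
  have hr0 : ∫ s, (h i t s * star (e i t s)).re ∂μ = 0 := by
    have := integral_re hi
    rw [hi0] at this
    simpa using this
  simp only [norm_add_sq_complex]
  have hsum : Integrable (fun s => ‖h i t s‖ ^ 2 + ‖e i t s‖ ^ 2) μ :=
    (hE.integrable_sq i t).add h3
  have hre : Integrable (fun s => 2 * (h i t s * star (e i t s)).re) μ := hi.re.const_mul 2
  refine ⟨hsum.add hre, ?_⟩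
  rw [integral_add hsum hre, integral_add (hE.integrable_sq i t) h3, hE.sq, h4,
    integral_const_mul, hr0, A, B]
  ring

-- The squared splitting matrix is diagonal, so only the diagonal of the Gram matrix enters, that
-- is, the squared norms of the precoder columns.
omit [MeasurableSpace S] in
lemma trace_precoder (hρ₀ : 0 ≤ p.ρ) (hρ₁ : p.ρ ≤ 1) (N K : ℕ) (s : S) :
    (Matrix.trace ((precoder h e N K s)ᴴ * precoder h e N K s * splitting p K ^ 2)).re =
      p.ρ * ∑ t : Fin N, ‖∑ i : Fin K, (h i t s + e i t s)‖ ^ 2 +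
        (1 - p.ρ) * ∑ i : Fin K, ∑ t : Fin N, ‖h i t s + e i t s‖ ^ 2 := by
  have hsq : ∀ x : ℝ, 0 ≤ x → ((Real.sqrt x : ℝ) : ℂ) * ((Real.sqrt x : ℝ) : ℂ) = (x : ℂ) := by
    intro x hx
    rw [← Complex.ofReal_mul, Real.mul_self_sqrt hx]
  have hn : ∀ z : ℂ, z * star z = ((‖z‖ ^ 2 : ℝ) : ℂ) := by
    intro z
    rw [← Complex.normSq_eq_norm_sq, ← Complex.mul_conj, RCLike.star_def]
  unfold splitting
  rw [pow_two, Matrix.diagonal_mul_diagonal, Matrix.trace]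
  simp only [Matrix.diag_apply, Matrix.mul_diagonal, Fin.sum_univ_succ, Fin.cons_zero,
    Fin.cons_succ, hsq _ hρ₀, hsq _ (sub_nonneg.2 hρ₁)]
  have h0 : ((precoder h e N K s)ᴴ * precoder h e N K s) 0 0 =
      ((∑ t : Fin N, ‖∑ i : Fin K, (h i t s + e i t s)‖ ^ 2 : ℝ) : ℂ) := by
    simp only [Matrix.mul_apply, Matrix.conjTranspose_apply, precoder, Matrix.of_apply,
      Fin.cons_zero, Finset.sum_apply, Pi.star_apply, ← star_sum, star_star, hn,
      Complex.ofReal_sum, est, vec, Pi.add_apply]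
  have h1 : ∀ i : Fin K, ((precoder h e N K s)ᴴ * precoder h e N K s) i.succ i.succ =
      ((∑ t : Fin N, ‖h i t s + e i t s‖ ^ 2 : ℝ) : ℂ) := by
    intro i
    simp only [Matrix.mul_apply, Matrix.conjTranspose_apply, precoder, Matrix.of_apply,
      Fin.cons_succ, Pi.star_apply, star_star, hn, Complex.ofReal_sum, est, vec, Pi.add_apply]
  simp only [h0, h1, ← Complex.ofReal_mul, ← Complex.ofReal_sum, ← Complex.ofReal_add,
    Complex.ofReal_re, ← Finset.sum_mul]
  ring

lemma norm_sum_sq {K : ℕ} (z : Fin K → ℂ) :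
    ‖∑ i, z i‖ ^ 2 = ∑ i, ∑ j, (z i * star (z j)).re := by
  have : ((‖∑ i, z i‖ ^ 2 : ℝ) : ℂ) = ∑ i, ∑ j, z i * star (z j) := by
    rw [← Complex.normSq_eq_norm_sq, ← Complex.mul_conj, map_sum, Finset.sum_mul_sum]
    rfl
  rw [← Complex.ofReal_re (‖∑ i, z i‖ ^ 2), this]
  simp only [Complex.re_sum]

/-- The entries have nonzero mean, so distinct users contribute the product of their means rather
than being orthogonal. This is the source of the double sum in α. -/
lemma IsChannelModel.integral_norm_sum_estimate_sq (H : IsChannelModel p μ h e)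
    (hm : ∀ i, 0 < p.m i)
    (hΩ : ∀ i, 0 < p.Ω i) (hb : ∀ i, 0 ≤ p.b i) (herr : ∀ i, 0 ≤ p.errVar i) (K t : ℕ) :
    Integrable (fun s => ‖∑ i : Fin K, (h i t s + e i t s)‖ ^ 2) μ ∧
      ∫ s, ‖∑ i : Fin K, (h i t s + e i t s)‖ ^ 2 ∂μ =
        ∑ i ∈ Finset.range K, B p i +
          ∑ i ∈ Finset.range K, ∑ j ∈ (Finset.range K).erase i, C p i * C p j := by
  have hind : iIndepFun (fun (x : ℕ × ℕ) s => h x.1 x.2 s + e x.1 x.2 s) μ :=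
    H.indep.comp (fun _ z => z.1 + z.2) fun _ => by fun_prop
  have hmean := H.estimate_mean hm hΩ hb herr
  have hsq := H.estimate_sq hm hΩ hb herr
  have key : ∀ i j : ℕ,
      Integrable (fun s => ((h i t s + e i t s) * star (h j t s + e j t s)).re) μ ∧
      ∫ s, ((h i t s + e i t s) * star (h j t s + e j t s)).re ∂μ =
        if i = j then B p i else C p i * C p j := by
    intro i j
    split_ifs with hij
    · subst hij
      have hn : ∀ z : ℂ, (z * star z).re = ‖z‖ ^ 2 := by
        intro z
        rw [RCLike.star_def, Complex.mul_conj, Complex.ofReal_re, Complex.normSq_eq_norm_sq]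
      simp only [hn]
      exact hsq i t
    · have hstar : Integrable (fun s => star (h j t s + e j t s)) μ :=
        (Complex.conjCLE : ℂ →L[ℝ] ℂ).integrable_comp (hmean j t).1
      have hstar' : ∫ s, star (h j t s + e j t s) ∂μ = C p j := by
        have := integral_conj (f := fun s => h j t s + e j t s) (μ := μ)
        rw [(hmean j t).2, Complex.conj_ofReal] at this
        exact this
      obtain ⟨h1, h2⟩ := indep_integral_mul_two hind (a := (i, t)) (b := (j, t)) (by simpa using hij)
        (f := fun z : ℂ => z) (g := fun z : ℂ => star z) (by fun_prop) (by fun_prop)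
        (hmean i t).1 hstar
      refine ⟨h1.re, ?_⟩
      have := integral_re h1
      rw [h2] at this
      simp only [(hmean i t).2, hstar', ← Complex.ofReal_mul] at this
      simpa using this
  have hi : ∀ i : Fin K, Integrable
      (fun s => ∑ j : Fin K, ((h i t s + e i t s) * star (h j t s + e j t s)).re) μ :=
    fun i => integrable_finsetSum _ fun j _ => (key i j).1
  simp only [norm_sum_sq]
  refine ⟨integrable_finsetSum _ fun i _ => hi i, ?_⟩
  rw [integral_finsetSum _ fun i _ => hi i,
    Finset.sum_range fun i => ∑ j ∈ (Finset.range K).erase i, C p i * C p j,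
    Finset.sum_range, ← Finset.sum_add_distrib]
  refine Finset.sum_congr rfl fun i _ => ?_
  rw [integral_finsetSum _ fun (j : Fin K) _ => (key i j).1]
  simp only [(key _ _).2]
  rw [← Finset.sum_range fun j => if (i : ℕ) = j then B p i else C p i * C p j,
    ← Finset.add_sum_erase _ _ (Finset.mem_range.2 i.2), if_pos rfl]
  congr 1
  exact Finset.sum_congr rfl fun j hj => if_neg (Finset.ne_of_mem_erase hj).symm

lemma IsChannelModel.alpha_eq (H : IsChannelModel p μ h e) (hm : ∀ i, 0 < p.m i)
    (hΩ : ∀ i, 0 < p.Ω i) (hb : ∀ i, 0 ≤ p.b i) (herr : ∀ i, 0 ≤ p.errVar i)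
    (hρ₀ : 0 ≤ p.ρ) (hρ₁ : p.ρ ≤ 1) (N K : ℕ) :
    alpha p μ h e N K =
      p.Pt / (N * ∑ i ∈ Finset.range K, B p i
        + p.ρ * N * ∑ i ∈ Finset.range K, ∑ j ∈ (Finset.range K).erase i, C p i * C p j) := by
  have h1 := H.integral_norm_sum_estimate_sq hm hΩ hb herr K
  have h2 := H.estimate_sq hm hΩ hb herr
  have i1 : Integrable (fun s => ∑ t : Fin N, ‖∑ i : Fin K, (h i t s + e i t s)‖ ^ 2) μ :=
    integrable_finsetSum _ fun t _ => (h1 t).1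
  have i2 : ∀ i : ℕ, Integrable (fun s => ∑ t : Fin N, ‖h i t s + e i t s‖ ^ 2) μ :=
    fun i => integrable_finsetSum _ fun t _ => (h2 i t).1
  have i3 : Integrable (fun s => ∑ i : Fin K, ∑ t : Fin N, ‖h i t s + e i t s‖ ^ 2) μ :=
    integrable_finsetSum _ fun i _ => i2 i
  unfold alpha
  simp only [trace_precoder hρ₀ hρ₁]
  rw [integral_add (i1.const_mul _) (i3.const_mul _), integral_const_mul, integral_const_mul,
    integral_finsetSum _ fun (t : Fin N) _ => (h1 t).1,
    integral_finsetSum _ fun (i : Fin K) _ => i2 i]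
  simp only [(h1 _).2]
  have : ∀ i : Fin K, ∫ s, ∑ t : Fin N, ‖h i t s + e i t s‖ ^ 2 ∂μ = N * B p i := by
    intro i
    rw [integral_finsetSum _ fun (t : Fin N) _ => (h2 i t).1]
    simp only [(h2 _ _).2]
    simp
  simp only [this, ← Finset.mul_sum, Finset.sum_const, Finset.card_univ, Fintype.card_fin,
    nsmul_eq_mul, ← Finset.sum_range fun i => B p i]
  congr 1
  ring

end RSMA

/-! ### Concentration: from relative variance to the mean of the logarithm. -/

namespace RSMA

variable {S : Type*} [MeasurableSpace S] {μ : Measure S}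

/-- The mean absolute deviation of `W` from its mean is at most `r` times its mean. -/
structure RelDev (μ : Measure S) (W : S → ℝ) (r : ℝ) : Prop where
  integrable : Integrable W μ
  dev_le : ∫ s, |W s - ∫ x, W x ∂μ| ∂μ ≤ r * ∫ x, W x ∂μ

lemma RelDev.mono {W : S → ℝ} {r r' : ℝ} (hW : RelDev μ W r) (h0 : 0 ≤ ∫ s, W s ∂μ)
    (hr : r ≤ r') : RelDev μ W r' :=
  ⟨hW.integrable, hW.dev_le.trans (mul_le_mul_of_nonneg_right hr h0)⟩

/-- The bound is linear in the mean, so the triangle inequality preserves r without any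
independence. Hence sums over arbitrarily many users cost nothing. -/
lemma RelDev.add [IsFiniteMeasure μ] {V W : S → ℝ} {r : ℝ} (hV : RelDev μ V r)
    (hW : RelDev μ W r) : RelDev μ (fun s => V s + W s) r := by
  refine ⟨hV.integrable.add hW.integrable, ?_⟩
  rw [integral_add hV.integrable hW.integrable, mul_add]
  refine le_trans ?_ (add_le_add hV.dev_le hW.dev_le)
  have h1 : Integrable (fun s => |V s - ∫ x, V x ∂μ|) μ :=
    (hV.integrable.sub (integrable_const (∫ x, V x ∂μ))).abs
  have h2 : Integrable (fun s => |W s - ∫ x, W x ∂μ|) μ :=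
    (hW.integrable.sub (integrable_const (∫ x, W x ∂μ))).abs
  rw [← integral_add h1 h2]
  refine integral_mono_of_nonneg (Eventually.of_forall fun s => abs_nonneg _) (h1.add h2)
    (Eventually.of_forall fun s => ?_)
  simp only [add_sub_add_comm]
  exact abs_add_le _ _

lemma RelDev.const_mul {W : S → ℝ} {r a : ℝ} (hW : RelDev μ W r) (ha : 0 ≤ a) :
    RelDev μ (fun s => a * W s) r := by
  refine ⟨hW.integrable.const_mul a, ?_⟩
  simp only [integral_const_mul, ← mul_sub, abs_mul, abs_of_nonneg ha]
  rw [mul_left_comm]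
  exact mul_le_mul_of_nonneg_left hW.dev_le ha

lemma RelDev.const [IsProbabilityMeasure μ] {r a : ℝ} (hr : 0 ≤ r) (ha : 0 ≤ a) :
    RelDev μ (fun _ : S => a) r := by
  refine ⟨integrable_const a, ?_⟩
  simpa using mul_nonneg hr ha

lemma RelDev.sum [IsProbabilityMeasure μ] {ι : Type*} (I : Finset ι) {W : ι → S → ℝ} {r : ℝ}
    (hr : 0 ≤ r) (hW : ∀ i ∈ I, RelDev μ (W i) r) : RelDev μ (fun s => ∑ i ∈ I, W i s) r := by
  classical
  induction I using Finset.induction_on with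
  | empty => simpa using RelDev.const (μ := μ) hr le_rfl
  | insert i I hi ih =>
    simp only [Finset.sum_insert hi]
    exact (hW i (Finset.mem_insert_self i I)).add
      (ih fun j hj => hW j (Finset.mem_insert_of_mem hj))

lemma integral_norm_sub_ofReal_sq [IsProbabilityMeasure μ] {T : S → ℂ} {τ : ℝ}
    (hT : Integrable T μ) (hT2 : Integrable (fun s => ‖T s‖ ^ 2) μ) (hτ : ∫ s, T s ∂μ = τ) :
    Integrable (fun s => ‖T s - τ‖ ^ 2) μ ∧
      ∫ s, ‖T s - τ‖ ^ 2 ∂μ = ∫ s, ‖T s‖ ^ 2 ∂μ - τ ^ 2 := by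
  have e : ∀ z : ℂ, ‖z - τ‖ ^ 2 = ‖z‖ ^ 2 - 2 * τ * z.re + τ ^ 2 := by
    intro z
    simp only [← Complex.normSq_eq_norm_sq, Complex.normSq_apply, Complex.sub_re, Complex.sub_im,
      Complex.ofReal_re, Complex.ofReal_im]
    ring
  have hre : ∫ s, (T s).re ∂μ = τ := by
    have := integral_re hT
    rw [hτ] at this
    simpa using this
  have h1 : Integrable (fun s => 2 * τ * (T s).re) μ := hT.re.const_mul _
  simp only [e]
  have h2 : Integrable (fun s => ‖T s‖ ^ 2 - 2 * τ * (T s).re) μ := hT2.sub h1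
  refine ⟨h2.add (integrable_const _), ?_⟩
  rw [integral_add h2 (integrable_const _), integral_sub hT2 h1, integral_const_mul, hre]
  simp
  ring

lemma sq_le_integral_norm_sq [IsProbabilityMeasure μ] {T : S → ℂ} {τ : ℝ}
    (hT : Integrable T μ) (hT2 : Integrable (fun s => ‖T s‖ ^ 2) μ) (hτ : ∫ s, T s ∂μ = τ) :
    τ ^ 2 ≤ ∫ s, ‖T s‖ ^ 2 ∂μ := by
  have h : 0 ≤ ∫ s, ‖T s - τ‖ ^ 2 ∂μ := integral_nonneg fun s => by positivity
  rw [(integral_norm_sub_ofReal_sq hT hT2 hτ).2] at h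
  linarith

/-- A complex variable with small relative variance has a concentrated squared modulus. -/
lemma relDev_norm_sq [IsProbabilityMeasure μ] {T : S → ℂ} {τ c n : ℝ} (hn : 1 ≤ n)
    (hT : Integrable T μ) (hT2 : Integrable (fun s => ‖T s‖ ^ 2) μ) (hτ : ∫ s, T s ∂μ = τ)
    (hc : 0 ≤ c) (hv : ∫ s, ‖T s‖ ^ 2 ∂μ - τ ^ 2 ≤ c * τ ^ 2 / n) :
    RelDev μ (fun s => ‖T s‖ ^ 2) ((3 * c + 1) / Real.sqrt n) := by
  refine ⟨hT2, ?_⟩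
  obtain ⟨hd, hδ⟩ := integral_norm_sub_ofReal_sq hT hT2 hτ
  have hle := sq_le_integral_norm_sq hT hT2 hτ
  set E := ∫ s, ‖T s‖ ^ 2 ∂μ with hE
  have hr1 : 1 ≤ Real.sqrt n := Real.one_le_sqrt.2 hn
  have hrr : Real.sqrt n * Real.sqrt n = n := Real.mul_self_sqrt (by linarith)
  set r := Real.sqrt n with hr
  have hr0 : 0 < r := by linarith
  -- Expand |T|^2 around τ and split the cross term by AM-GM. The weight r = √n balances r times the
  -- variance, of order τ^2 / n, against τ^2 / r.
  have key : ∀ s, |‖T s‖ ^ 2 - E| ≤ (1 + r) * ‖T s - τ‖ ^ 2 + (τ ^ 2 / r + (E - τ ^ 2)) := by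
    intro s
    have e : ‖T s‖ ^ 2 = ‖T s - τ‖ ^ 2 + 2 * τ * (T s - τ).re + τ ^ 2 := by
      simp only [← Complex.normSq_eq_norm_sq, Complex.normSq_apply, Complex.sub_re,
        Complex.sub_im, Complex.ofReal_re, Complex.ofReal_im]
      ring
    have hre := Complex.abs_re_le_norm (T s - τ)
    set x := (T s - τ).re
    set y := ‖T s - τ‖
    have hx : x ^ 2 ≤ y ^ 2 := sq_le_sq' (by linarith [neg_abs_le x]) (by linarith [le_abs_self x])
    have h2 : |2 * τ * x| ≤ r * y ^ 2 + τ ^ 2 / r := by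
      have h3 : r * y ^ 2 + τ ^ 2 / r ≥ r * x ^ 2 + τ ^ 2 / r := by gcongr
      have h4 : r * x ^ 2 + τ ^ 2 / r - 2 * τ * x = (r * x - τ) ^ 2 / r := by field_simp; ring
      have h5 : r * x ^ 2 + τ ^ 2 / r + 2 * τ * x = (r * x + τ) ^ 2 / r := by field_simp; ring
      have h6 : 0 ≤ (r * x - τ) ^ 2 / r := by positivity
      have h7 : 0 ≤ (r * x + τ) ^ 2 / r := by positivity
      rw [abs_le]
      constructor <;> linarith
    have h8 := abs_le.1 h2
    have hy : 0 ≤ y ^ 2 := sq_nonneg y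
    rw [e, abs_le]
    constructor <;> linarith [h8.1, h8.2]
  have hint : Integrable (fun s => (1 + r) * ‖T s - τ‖ ^ 2 + (τ ^ 2 / r + (E - τ ^ 2))) μ :=
    (hd.const_mul _).add (integrable_const _)
  refine (integral_mono_of_nonneg (Eventually.of_forall fun s => abs_nonneg _) hint
    (Eventually.of_forall key)).trans ?_
  rw [integral_add (hd.const_mul _) (integrable_const _), integral_const_mul, hδ]
  simp only [integral_const, probReal_univ, smul_eq_mul, one_mul]
  have h9 : E - τ ^ 2 ≤ c * τ ^ 2 / (r * r) := by rw [hrr]; exact hv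
  -- This is 2 + r ≤ 3r, where r ≥ 1 is used.
  have h10 : c * τ ^ 2 / (r * r) * (2 + r) ≤ 3 * c * τ ^ 2 / r := by
    rw [div_mul_eq_mul_div, div_le_div_iff₀ (by positivity) hr0]
    have : 0 ≤ c * τ ^ 2 * r := by positivity
    nlinarith
  calc (1 + r) * (E - τ ^ 2) + (τ ^ 2 / r + (E - τ ^ 2))
      = (E - τ ^ 2) * (2 + r) + τ ^ 2 / r := by ring
    _ ≤ c * τ ^ 2 / (r * r) * (2 + r) + τ ^ 2 / r := by gcongr
    _ ≤ 3 * c * τ ^ 2 / r + τ ^ 2 / r := by gcongr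
    _ = (3 * c + 1) / r * τ ^ 2 := by ring
    _ ≤ (3 * c + 1) / r * E := by gcongr

/-- A nonnegative real variable with small relative variance is concentrated. -/
lemma relDev_of_variance [IsProbabilityMeasure μ] {W : S → ℝ} {τ c n : ℝ} (hn : 1 ≤ n)
    (hW : Integrable W μ) (hW2 : Integrable (fun s => W s ^ 2) μ) (hτ : ∫ s, W s ∂μ = τ)
    (hτ0 : 0 < τ) (hv : ∫ s, W s ^ 2 ∂μ - τ ^ 2 ≤ c * τ ^ 2 / n) :
    RelDev μ W ((c + 1) / Real.sqrt n) := by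
  refine ⟨hW, ?_⟩
  have hT : Integrable (fun s => (W s : ℂ)) μ := hW.ofReal
  have hT2 : Integrable (fun s => ‖(W s : ℂ)‖ ^ 2) μ := by simpa using hW2
  obtain ⟨hd, hδ⟩ := integral_norm_sub_ofReal_sq hT hT2
    (by rw [integral_complex_ofReal, hτ])
  have e : ∀ s, ‖(W s : ℂ) - τ‖ ^ 2 = (W s - τ) ^ 2 := by
    intro s
    rw [← Complex.ofReal_sub, Complex.norm_real, Real.norm_eq_abs, sq_abs]
  simp only [e, Complex.norm_real, Real.norm_eq_abs, sq_abs] at hd hδ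
  rw [hτ]
  have hr1 : 1 ≤ Real.sqrt n := Real.one_le_sqrt.2 hn
  have hrr : Real.sqrt n * Real.sqrt n = n := Real.mul_self_sqrt (by linarith)
  set r := Real.sqrt n with hr
  have hr0 : 0 < r := by linarith
  have key : ∀ s, |W s - τ| ≤ r / τ * (W s - τ) ^ 2 + τ / r := by
    intro s
    set x := W s - τ
    have h1 : 0 ≤ (r * |x| - τ) ^ 2 / (r * τ) := by positivity
    have h2 : (r * |x| - τ) ^ 2 / (r * τ) = r / τ * |x| ^ 2 + τ / r - 2 * |x| := by
      field_simp
      ring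
    rw [sq_abs] at h2
    linarith [abs_nonneg x]
  have hint : Integrable (fun s => r / τ * (W s - τ) ^ 2 + τ / r) μ :=
    (hd.const_mul _).add (integrable_const _)
  refine (integral_mono_of_nonneg (Eventually.of_forall fun s => abs_nonneg _) hint
    (Eventually.of_forall key)).trans ?_
  rw [integral_add (hd.const_mul _) (integrable_const _), integral_const_mul, hδ]
  simp only [integral_const, probReal_univ, smul_eq_mul, one_mul]
  rw [← hrr] at hv
  calc r / τ * (∫ s, W s ^ 2 ∂μ - τ ^ 2) + τ / r
      ≤ r / τ * (c * τ ^ 2 / (r * r)) + τ / r := by gcongr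
    _ = (c + 1) / r * τ := by field_simp

/-- For v ≥ 1/2 the logarithm is 2-Lipschitz; for v ≤ 1/2 the bound ℓ is absorbed by 2|v - 1| ≥ 1.
-/
lemma abs_log_le {v ℓ : ℝ} (hℓ : 0 ≤ ℓ) (hv : 0 < v) (hvℓ : -ℓ ≤ Real.log v) :
    |Real.log v| ≤ 2 * (1 + ℓ) * |v - 1| := by
  rcases le_total 1 v with h1 | h1
  · rw [abs_of_nonneg (Real.log_nonneg h1), abs_of_nonneg (sub_nonneg.2 h1)]
    have := Real.log_le_sub_one_of_pos hv
    nlinarith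
  · rw [abs_of_nonpos (Real.log_nonpos hv.le h1), abs_of_nonpos (sub_nonpos.2 h1)]
    rcases le_total (1 / 2) v with h2 | h2
    · have h3 := Real.one_sub_inv_le_log_of_pos hv
      have h4 : v⁻¹ - 1 ≤ 2 * (1 - v) := by
        rw [show v⁻¹ - 1 = (1 - v) / v by field_simp, div_le_iff₀ hv]
        nlinarith
      nlinarith
    · nlinarith

/-- Apply `abs_log_le` to W / E W, which is at least σ / L. The lower bound σ controls the
singularity of the logarithm at a price only logarithmic in L. -/
lemma RelDev.log [IsProbabilityMeasure μ] {W : S → ℝ} {r σ L : ℝ} (hW : RelDev μ W r)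
    (hσ : 0 < σ) (hWσ : ∀ s, σ ≤ W s) (hL : ∫ s, W s ∂μ ≤ L) :
    Integrable (fun s => Real.log (W s)) μ ∧
      |∫ s, Real.log (W s) ∂μ - Real.log (∫ s, W s ∂μ)| ≤ 2 * (1 + Real.log (L / σ)) * r := by
  have hwσ : σ ≤ ∫ s, W s ∂μ := by
    have := integral_mono (integrable_const σ) hW.integrable hWσ
    simpa using this
  set w := ∫ s, W s ∂μ with hw
  have hw0 : 0 < w := hσ.trans_le hwσ
  have hL0 : 0 < L := hw0.trans_le hL
  have hℓ : 0 ≤ Real.log (L / σ) := Real.log_nonneg ((one_le_div hσ).2 (hwσ.trans hL))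
  have key : ∀ s, |Real.log (W s) - Real.log w| ≤
      2 * (1 + Real.log (L / σ)) / w * |W s - w| := by
    intro s
    have hs : 0 < W s := hσ.trans_le (hWσ s)
    have h1 := abs_log_le hℓ (div_pos hs hw0) (by
      rw [← Real.log_inv, inv_div]
      exact Real.log_le_log (by positivity) (div_le_div₀ hs.le (hWσ s) hw0 hL))
    rw [Real.log_div hs.ne' hw0.ne', div_sub_one hw0.ne', abs_div, abs_of_pos hw0] at h1
    rw [div_mul_eq_mul_div, ← mul_div_assoc']
    exact h1
  have hd : Integrable (fun s => |W s - w|) μ := (hW.integrable.sub (integrable_const w)).abs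
  have hmeas : AEStronglyMeasurable (fun s => Real.log (W s)) μ :=
    (Real.measurable_log.comp_aemeasurable hW.integrable.aemeasurable).aestronglyMeasurable
  have hi : Integrable (fun s => Real.log (W s) - Real.log w) μ :=
    (hd.const_mul (2 * (1 + Real.log (L / σ)) / w)).mono'
      (hmeas.sub aestronglyMeasurable_const) (Eventually.of_forall key)
  have hlog : Integrable (fun s => Real.log (W s)) μ := by
    have := hi.add (integrable_const (Real.log w))
    refine this.congr (Eventually.of_forall fun s => ?_)
    simp
  refine ⟨hlog, ?_⟩
  have e : ∫ s, Real.log (W s) ∂μ - Real.log w = ∫ s, (Real.log (W s) - Real.log w) ∂μ := by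
    rw [integral_sub hlog (integrable_const _)]
    simp
  rw [e]
  calc |∫ s, (Real.log (W s) - Real.log w) ∂μ|
      ≤ ∫ s, |Real.log (W s) - Real.log w| ∂μ := abs_integral_le_integral_abs
    _ ≤ ∫ s, 2 * (1 + Real.log (L / σ)) / w * |W s - w| ∂μ :=
        integral_mono hi.abs (hd.const_mul _) key
    _ = 2 * (1 + Real.log (L / σ)) / w * ∫ s, |W s - w| ∂μ := integral_const_mul _ _
    _ ≤ 2 * (1 + Real.log (L / σ)) / w * (r * w) := by
        gcongr
        exact hW.dev_le
    _ = 2 * (1 + Real.log (L / σ)) * r := by field_simp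

lemma tendsto_log_mul_div_sqrt {L σ : ℝ} (hL : 0 < L) (hσ : 0 < σ) (R : ℝ) :
    Tendsto (fun N : ℕ => 2 * (1 + Real.log (L * N / σ)) * (R / Real.sqrt N)) atTop (𝓝 0) := by
  have h1 : Tendsto (fun x : ℝ => Real.log x / x ^ (1 / 2 : ℝ)) atTop (𝓝 0) :=
    (isLittleO_log_rpow_atTop (by norm_num)).tendsto_div_nhds_zero
  have h2 : Tendsto (fun x : ℝ => (x ^ (1 / 2 : ℝ))⁻¹) atTop (𝓝 0) :=
    (tendsto_rpow_atTop (by norm_num)).inv_tendsto_atTop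
  have h3 := ((h2.const_mul (2 * R * (1 + Real.log (L / σ)))).add (h1.const_mul (2 * R))).comp
    tendsto_natCast_atTop_atTop
  simp only [mul_zero, add_zero] at h3
  refine h3.congr' ?_
  filter_upwards [eventually_ge_atTop 1] with N hN
  have hN' : (0 : ℝ) < N := by exact_mod_cast hN
  simp only [Function.comp_apply, ← Real.sqrt_eq_rpow]
  rw [mul_div_right_comm, Real.log_mul (by positivity) hN'.ne']
  ring

end RSMA

/-! ### Mean and variance of the inner products, uniformly in the other user. -/

namespace RSMA

variable {S : Type*} [MeasurableSpace S] {μ : Measure S}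

/-- `T` has a real mean of order `n * x` and a variance of order at most `n * x ^ 2`. -/
structure MeanVarBound (μ : Measure S) (T : S → ℂ) (n x γ β κ : ℝ) : Prop where
  integrable : Integrable T μ
  integrable_sq : Integrable (fun s => ‖T s‖ ^ 2) μ
  exists_mean : ∃ τ : ℝ, ∫ s, T s ∂μ = τ ∧ n * γ * x ≤ τ ∧ τ ≤ n * β * x ∧
    ∫ s, ‖T s‖ ^ 2 ∂μ - τ ^ 2 ≤ n * κ * x ^ 2

namespace MeanVarBound

variable {T : S → ℂ} {n x γ β κ : ℝ}

lemma relDev [IsProbabilityMeasure μ] (H : MeanVarBound μ T n x γ β κ) (hn : 1 ≤ n) (hx : 0 ≤ x)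
    (hγ : 0 < γ) (hκ : 0 ≤ κ) :
    RelDev μ (fun s => ‖T s‖ ^ 2) ((3 * (κ / γ ^ 2) + 1) / Real.sqrt n) := by
  obtain ⟨τ, hτ, hlo, -, hv⟩ := H.exists_mean
  refine relDev_norm_sq hn H.integrable H.integrable_sq hτ (by positivity) (hv.trans ?_)
  have h1 : (n * γ * x) ^ 2 ≤ τ ^ 2 := by gcongr
  calc n * κ * x ^ 2 = κ / γ ^ 2 * (n * γ * x) ^ 2 / n := by field_simp
    _ ≤ κ / γ ^ 2 * τ ^ 2 / n := by gcongr

lemma integral_norm_sq_le (H : MeanVarBound μ T n x γ β κ) (hn : 1 ≤ n) (hx : 0 ≤ x)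
    (hγ : 0 ≤ γ) (hκ : 0 ≤ κ) : ∫ s, ‖T s‖ ^ 2 ∂μ ≤ n ^ 2 * (β ^ 2 + κ) * x ^ 2 := by
  obtain ⟨τ, hτ, hlo, hhi, hv⟩ := H.exists_mean
  have hτ0 : 0 ≤ τ := le_trans (by positivity) hlo
  have h1 : τ ^ 2 ≤ (n * β * x) ^ 2 := by gcongr
  have h2 : n * κ * x ^ 2 ≤ n ^ 2 * κ * x ^ 2 := by
    gcongr
    nlinarith
  nlinarith

/-- Weighted Cauchy-Schwarz: the bound is inherited by sums without loss in the constants. -/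
lemma sum [IsProbabilityMeasure μ] {ι : Type*} {I : Finset ι} {T : ι → S → ℂ} {x : ι → ℝ}
    (hx : ∀ i, 0 < x i) (H : ∀ i, MeanVarBound μ (T i) n (x i) γ β κ)
    (hI : Integrable (fun s => ‖∑ i ∈ I, T i s‖ ^ 2) μ) :
    MeanVarBound μ (fun s => ∑ i ∈ I, T i s) n (∑ i ∈ I, x i) γ β κ := by
  choose τ hτ hlo hhi hv using fun i => (H i).exists_mean
  have hint : Integrable (fun s => ∑ i ∈ I, T i s) μ :=
    integrable_finsetSum _ fun i _ => (H i).integrable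
  have hmean : ∫ s, ∑ i ∈ I, T i s ∂μ = ((∑ i ∈ I, τ i : ℝ) : ℂ) := by
    rw [integral_finsetSum _ fun i _ => (H i).integrable]
    simp [hτ]
  refine ⟨hint, hI, ∑ i ∈ I, τ i, hmean, ?_, ?_, ?_⟩
  · rw [Finset.mul_sum]
    exact Finset.sum_le_sum fun i _ => hlo i
  · rw [Finset.mul_sum]
    exact Finset.sum_le_sum fun i _ => hhi i
  · have hd := fun i => integral_norm_sub_ofReal_sq (H i).integrable (H i).integrable_sq (hτ i)
    rw [← (integral_norm_sub_ofReal_sq hint hI hmean).2]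
    have key : ∀ s, ‖∑ i ∈ I, T i s - ((∑ i ∈ I, τ i : ℝ) : ℂ)‖ ^ 2 ≤
        (∑ i ∈ I, x i) * ∑ i ∈ I, (x i)⁻¹ * ‖T i s - τ i‖ ^ 2 := by
      intro s
      rw [Complex.ofReal_sum, ← Finset.sum_sub_distrib]
      refine (pow_le_pow_left₀ (norm_nonneg _) (norm_sum_le _ _) 2).trans ?_
      -- Cauchy-Schwarz with weights x i: after division by x i, each centred square has mean at
      -- most n κ x i, and these sum to the second factor ∑ x i.
      refine Finset.sum_sq_le_sum_mul_sum_of_sq_le_mul I (fun i _ => (hx i).le)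
        (fun i _ => mul_nonneg (inv_nonneg.2 (hx i).le) (sq_nonneg _)) fun i _ => ?_
      rw [mul_inv_cancel_left₀ (hx i).ne']
    have hs : Integrable (fun s => ∑ i ∈ I, (x i)⁻¹ * ‖T i s - τ i‖ ^ 2) μ :=
      integrable_finsetSum _ fun i _ => (hd i).1.const_mul _
    refine (integral_mono_of_nonneg (Eventually.of_forall fun s => sq_nonneg _)
      (hs.const_mul _) (Eventually.of_forall key)).trans ?_
    rw [integral_const_mul, integral_finsetSum _ fun i _ => (hd i).1.const_mul _]
    have hx0 : 0 ≤ ∑ i ∈ I, x i := Finset.sum_nonneg fun i _ => (hx i).le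
    calc (∑ i ∈ I, x i) * ∑ i ∈ I, ∫ s, (x i)⁻¹ * ‖T i s - τ i‖ ^ 2 ∂μ
        ≤ (∑ i ∈ I, x i) * ∑ i ∈ I, n * κ * x i := by
          refine mul_le_mul_of_nonneg_left (Finset.sum_le_sum fun i _ => ?_) hx0
          rw [integral_const_mul, (hd i).2, inv_mul_le_iff₀ (hx i)]
          exact (hv i).trans (by rw [pow_two]; ring_nf; rfl)
      _ = n * κ * (∑ i ∈ I, x i) ^ 2 := by rw [← Finset.mul_sum]; ring

end MeanVarBound

/-- The pattern of coincidences among i, j and k separates the terms that become D, F, E and G. -/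
lemma sum_sum_eq_of_mem {ι : Type*} [DecidableEq ι] {I : Finset ι} {k : ι} (hk : k ∈ I)
    (φ : ι → ι → ℝ) :
    ∑ i ∈ I, ∑ j ∈ I, φ i j = φ k k + ∑ i ∈ I.erase k, (φ i k + φ k i + φ i i) +
      ∑ i ∈ I.erase k, ∑ j ∈ (I.erase k).erase i, φ i j := by
  have h1 : ∀ i ∈ I.erase k, ∑ j ∈ I, φ i j =
      φ i k + φ i i + ∑ j ∈ (I.erase k).erase i, φ i j := by
    intro i hi
    rw [← Finset.add_sum_erase _ _ hk, ← Finset.add_sum_erase _ _ hi, add_assoc]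
  rw [← Finset.add_sum_erase _ _ hk, ← Finset.add_sum_erase _ _ hk, Finset.sum_congr rfl h1]
  simp only [Finset.sum_add_distrib]
  ring

lemma herm_sum {N : ℕ} (u : Fin N → ℂ) {ι : Type*} (I : Finset ι) (v : ι → Fin N → ℂ) :
    herm u (∑ i ∈ I, v i) = ∑ i ∈ I, herm u (v i) := by
  simp only [herm, star_sum, dotProduct_sum]

lemma norm_finsetSum_sq {ι : Type*} (I : Finset ι) (z : ι → ℂ) :
    ‖∑ i ∈ I, z i‖ ^ 2 = ∑ i ∈ I, ∑ j ∈ I, (star (z i) * z j).re := by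
  have : ((‖∑ i ∈ I, z i‖ ^ 2 : ℝ) : ℂ) = ∑ i ∈ I, ∑ j ∈ I, star (z i) * z j := by
    rw [← Complex.normSq_eq_norm_sq, ← Complex.mul_conj, mul_comm, map_sum, Finset.sum_mul_sum]
    rfl
  rw [← Complex.ofReal_re (‖∑ i ∈ I, z i‖ ^ 2), this]
  simp only [Complex.re_sum]

namespace IndepEntries

variable {h : ℕ → ℕ → S → ℂ} {c a q f : ℕ → ℝ} (H : IndepEntries μ h c a q f)

include H

lemma sq_mean_le [IsProbabilityMeasure μ] (i : ℕ) : c i ^ 2 ≤ a i := by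
  rw [← H.sq i 0]
  exact sq_le_integral_norm_sq (H.integrable i 0) (H.integrable_sq i 0) (H.mean i 0)

lemma fourth_nonneg (i : ℕ) : 0 ≤ q i := by
  rw [← H.four i 0]
  exact integral_nonneg fun s => by positivity

lemma integrable_herm_mul_herm (N k i j : ℕ) :
    Integrable (fun s => herm (vec h N i s) (vec h N k s) * herm (vec h N k s) (vec h N j s)) μ := by
  rcases eq_or_ne i k with rfl | hik
  · rcases eq_or_ne j i with rfl | hjk
    · simp only [herm_self, ← pow_two, ← Complex.ofReal_pow]
      exact (H.integral_sqNorm_sq N j).1.ofReal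
    · have := (Complex.conjCLE : ℂ →L[ℝ] ℂ).integrable_comp (H.integral_herm_mul_herm_self N hjk).1
      refine this.congr (Eventually.of_forall fun s => ?_)
      change star _ = _
      rw [star_mul, star_herm, star_herm]
  · rcases eq_or_ne j k with rfl | hjk
    · exact (H.integral_herm_mul_herm_self N hik).1
    · rcases eq_or_ne i j with rfl | hij
      · simpa only [mul_comm] using (H.integral_herm_mul_herm_same N hik).1
      · exact (H.integral_herm_mul_herm_distinct N hik hjk hij).1

lemma integrable_norm_herm_sq (N k i : ℕ) :
    Integrable (fun s => ‖herm (vec h N k s) (vec h N i s)‖ ^ 2) μ := by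
  have := (H.integrable_herm_mul_herm N k i i).re
  refine this.congr (Eventually.of_forall fun s => ?_)
  change (herm (vec h N i s) (vec h N k s) * herm (vec h N k s) (vec h N i s)).re = _
  rw [mul_comm, ← norm_herm_sq, Complex.ofReal_re]

lemma E_eq (N : ℕ) {k i : ℕ} (hik : i ≠ k) :
    E μ h N k i = N * a k * a i + N * ((N : ℝ) - 1) * c k ^ 2 * c i ^ 2 := by
  have h1 := (H.integral_herm_mul_herm_same N hik).2
  simp only [← norm_herm_sq] at h1
  rw [integral_complex_ofReal] at h1
  unfold E
  apply Complex.ofReal_injective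
  rw [h1]
  push_cast
  ring

lemma D_eq (N k : ℕ) : D μ h N k = N * (q k - a k ^ 2) + (N : ℝ) ^ 2 * a k ^ 2 := by
  rw [D, (H.integral_sqNorm_sq N k).2]
  ring

lemma F_eq (N : ℕ) {k i : ℕ} (hik : i ≠ k) :
    F μ h N i k = ((N * c i * (f k + c k * ((N : ℝ) - 1) * a k) : ℝ) : ℂ) := by
  have h1 := (H.integral_herm_mul_herm_self N hik).2
  simp only [herm_self] at h1
  rw [F, h1]
  push_cast
  ring

lemma G_eq (N : ℕ) {k i j : ℕ} (hik : i ≠ k) (hjk : j ≠ k) (hij : i ≠ j) :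
    G μ h N i k j = ((N * c i * c j * (a k + ((N : ℝ) - 1) * c k ^ 2) : ℝ) : ℂ) := by
  rw [G, (H.integral_herm_mul_herm_distinct N hik hjk hij).2]
  push_cast
  ring

/-- The expected power of the common message in terms of the joint moments. -/
lemma integral_norm_herm_sum_sq (N : ℕ) {k : ℕ} {I : Finset ℕ} (hk : k ∈ I) :
    Integrable (fun s => ‖herm (vec h N k s) (∑ i ∈ I, vec h N i s)‖ ^ 2) μ ∧
      ∫ s, ‖herm (vec h N k s) (∑ i ∈ I, vec h N i s)‖ ^ 2 ∂μ =
        D μ h N k + ∑ i ∈ I.erase k, (2 * (F μ h N i k).re + E μ h N k i)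
          + ∑ i ∈ I.erase k, ∑ j ∈ (I.erase k).erase i, (G μ h N i k j).re := by
  simp only [herm_sum, norm_finsetSum_sq, star_herm]
  have hi : ∀ i j, Integrable (fun s =>
      (herm (vec h N i s) (vec h N k s) * herm (vec h N k s) (vec h N j s)).re) μ :=
    fun i j => (H.integrable_herm_mul_herm N k i j).re
  have hr : ∀ i j, ∫ s, (herm (vec h N i s) (vec h N k s) * herm (vec h N k s) (vec h N j s)).re ∂μ
      = (G μ h N i k j).re := fun i j => integral_re (H.integrable_herm_mul_herm N k i j)
  have hsum : ∀ i, Integrable (fun s => ∑ j ∈ I,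
      (herm (vec h N i s) (vec h N k s) * herm (vec h N k s) (vec h N j s)).re) μ :=
    fun i => integrable_finsetSum _ fun j _ => hi i j
  refine ⟨integrable_finsetSum _ fun i _ => hsum i, ?_⟩
  rw [integral_finsetSum _ fun i _ => hsum i]
  simp only [integral_finsetSum _ fun j _ => hi _ j, hr]
  rw [sum_sum_eq_of_mem hk]
  have hD : (G μ h N k k k).re = D μ h N k := by
    rw [← hr, D]
    simp only [herm_self, ← pow_two, ← Complex.ofReal_pow, Complex.ofReal_re]
  have hF : ∀ i, (G μ h N i k k).re = (F μ h N i k).re := by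
    intro i
    simp only [G, F, herm_self]
  -- The two integrands are complex conjugates; hence the factor 2 on the real part of F.
  have hF' : ∀ i, (G μ h N k k i).re = (F μ h N i k).re := by
    intro i
    rw [← hF, ← hr, ← hr]
    congr 1
    ext s
    rw [← star_herm (vec h N i s) (vec h N k s), herm_self, ← Complex.conj_re]
    simp [mul_comm]
  have hE : ∀ i, (G μ h N i k i).re = E μ h N k i := by
    intro i
    rw [← hr, E]
    congr 1
    ext s
    rw [mul_comm, ← norm_herm_sq, Complex.ofReal_re]
  simp only [hD, hF, hF', hE, two_mul]

/-- In the variance for i ≠ k the N^2 terms cancel, and the rest is at most N a_k a_i. The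
hypothesis on M turns this into a multiple of c_i^2, the scale that `MeanVarBound.sum` needs. -/
lemma exists_meanVarBound [IsProbabilityMeasure μ] (hc : ∀ i, 0 < c i) {M : ℝ}
    (hM : ∀ i, a i ≤ M * c i ^ 2) (k : ℕ) :
    ∃ β κ : ℝ, 0 ≤ κ ∧ ∀ N i : ℕ,
      MeanVarBound μ (fun s => herm (vec h N k s) (vec h N i s)) N (c i) (c k) β κ := by
  have hck := hc k
  have hak : c k ^ 2 ≤ a k := H.sq_mean_le k
  have hak0 : 0 < a k := lt_of_lt_of_le (by positivity) hak
  have hq := H.fourth_nonneg k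
  have hM0 : 0 ≤ M := by
    by_contra hneg
    have := hM k
    nlinarith
  -- One choice serves both cases. For i = k the mean N a_k forces β = a_k / c_k, which suffices for
  -- i ≠ k since c_k^2 ≤ a_k; the summands of κ serve i ≠ k and i = k respectively.
  refine ⟨a k / c k, a k * M + q k / c k ^ 2, by positivity, fun N i => ?_⟩
  have hN : (0 : ℝ) ≤ N := N.cast_nonneg
  rcases eq_or_ne i k with rfl | hik
  · refine ⟨?_, H.integrable_norm_herm_sq N i i, N * a i, ?_, ?_, ?_, ?_⟩
    · simp only [herm_self]
      exact (H.integral_sqNorm N i).1.ofReal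
    · simp only [herm_self]
      rw [integral_complex_ofReal, (H.integral_sqNorm N i).2]
    · rw [mul_assoc, ← pow_two]
      gcongr
    · rw [mul_assoc, div_mul_cancel₀ _ hck.ne']
    · simp only [herm_self, Complex.norm_real, Real.norm_eq_abs, sq_abs]
      rw [(H.integral_sqNorm_sq N i).2]
      have e : N * (a i * M + q i / c i ^ 2) * c i ^ 2 = N * (a i * M * c i ^ 2) + N * q i := by
        field_simp
      rw [e]
      have h1 : 0 ≤ N * (a i * M * c i ^ 2) := by positivity
      have h2 : 0 ≤ N * a i ^ 2 := by positivity
      nlinarith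
  · obtain ⟨h1, h2⟩ := H.integral_herm N (k := k) (i := i) hik.symm
    refine ⟨h1, H.integrable_norm_herm_sq N k i, N * (c k * c i), ?_, ?_, ?_, ?_⟩
    · rw [h2]
      push_cast
      ring
    · rw [mul_assoc]
    · rw [mul_assoc]
      have := (hc i).le
      gcongr
      rw [le_div_iff₀ hck, ← pow_two]
      exact hak
    · have hE := H.E_eq N hik
      rw [E] at hE
      rw [hE]
      have h3 : N * a k * a i ≤ N * a k * (M * c i ^ 2) :=
        mul_le_mul_of_nonneg_left (hM i) (by positivity)
      have h4 : 0 ≤ N * (q k / c k ^ 2) * c i ^ 2 := by positivity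
      have h5 : 0 ≤ N * c k ^ 2 * c i ^ 2 := by positivity
      nlinarith

lemma sqNorm_relDev [IsProbabilityMeasure μ] {k : ℕ} (hak : 0 < a k) {N : ℕ} (hN : 1 ≤ N) :
    RelDev μ (fun s => sqNorm (vec h N k s)) ((q k / a k ^ 2 + 1) / Real.sqrt N) := by
  have hN' : (1 : ℝ) ≤ N := by exact_mod_cast hN
  obtain ⟨h1, h2⟩ := H.integral_sqNorm N k
  obtain ⟨h3, h4⟩ := H.integral_sqNorm_sq N k
  refine relDev_of_variance hN' h1 h3 h2 (by positivity) ?_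
  rw [h4]
  have e : q k / a k ^ 2 * (N * a k) ^ 2 / N = N * q k := by field_simp
  rw [e]
  have : 0 ≤ N * a k ^ 2 := by positivity
  nlinarith

end IndepEntries

end RSMA

/-! ### Uniform bounds on the channel parameters. -/

namespace RSMA

/-- Log-convexity of Γ at m + 1, the midpoint of m + 1/2 and m + 3/2, bounds the squared ratio below
by m · m / (m + 1/2); the factor m / (m + 1/2) increases with m. -/
lemma mul_le_Gamma_ratio_sq {m₀ m : ℝ} (h0 : 0 < m₀) (hm : m₀ ≤ m) :
    m₀ / (m₀ + 1 / 2) * m ≤ (Real.Gamma (m + 1 / 2) / Real.Gamma m) ^ 2 := by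
  have hm0 : 0 < m := h0.trans_le hm
  have hG := Real.Gamma_pos_of_pos hm0
  have hG' := Real.Gamma_pos_of_pos (show 0 < m + 1 / 2 by positivity)
  have h1 := Real.Gamma_mul_add_mul_le_rpow_Gamma_mul_rpow_Gamma
    (show 0 < m + 1 / 2 by positivity) (show 0 < (m + 1 / 2) + 1 by positivity)
    (show (0 : ℝ) < 1 / 2 by norm_num) (show (0 : ℝ) < 1 / 2 by norm_num) (by norm_num)
  rw [Real.Gamma_add_one (by positivity : m + 1 / 2 ≠ 0),
    show 1 / 2 * (m + 1 / 2) + 1 / 2 * (m + 1 / 2 + 1) = m + 1 by ring, Real.Gamma_add_one hm0.ne',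
    ← Real.mul_rpow hG'.le (by positivity), ← Real.sqrt_eq_rpow] at h1
  have h2 : (m * Real.Gamma m) ^ 2 ≤ (m + 1 / 2) * Real.Gamma (m + 1 / 2) ^ 2 := by
    calc (m * Real.Gamma m) ^ 2 ≤ Real.sqrt (Real.Gamma (m + 1 / 2) *
          ((m + 1 / 2) * Real.Gamma (m + 1 / 2))) ^ 2 := by gcongr
      _ = (m + 1 / 2) * Real.Gamma (m + 1 / 2) ^ 2 := by
        rw [Real.sq_sqrt (by positivity)]
        ring
  have h3 : m₀ / (m₀ + 1 / 2) ≤ m / (m + 1 / 2) := by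
    rw [div_le_div_iff₀ (by positivity) (by positivity)]
    nlinarith
  calc m₀ / (m₀ + 1 / 2) * m ≤ m / (m + 1 / 2) * m := by gcongr
    _ ≤ (Real.Gamma (m + 1 / 2) / Real.Gamma m) ^ 2 := by
      rw [div_pow, div_mul_eq_mul_div, div_le_div_iff₀ (by positivity) (by positivity)]
      nlinarith

section Parameters

variable {p : Params}

lemma C_pos (hm : ∀ i, 0 < p.m i) (hΩ : ∀ i, 0 < p.Ω i) (i : ℕ) : 0 < C p i := by
  have h1 := hm i
  have h2 := hΩ i
  have h3 := Real.Gamma_pos_of_pos h1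
  have h4 := Real.Gamma_pos_of_pos (show 0 < p.m i + 1 / 2 by positivity)
  unfold C
  positivity

/-- The mean of a channel coefficient carries a fixed fraction of its power. -/
lemma exists_A_le_mul_C_sq (hm : ∃ m₀ : ℝ, 0 < m₀ ∧ ∀ i, m₀ ≤ p.m i) (hΩ : ∀ i, 0 < p.Ω i)
    (hb : ∀ i, 0 ≤ p.b i) (hbΩ : ∃ κ : ℝ, ∀ i, p.b i ≤ κ * p.Ω i) :
    ∃ M : ℝ, ∀ i, A p i ≤ M * C p i ^ 2 := by
  obtain ⟨m₀, h0, hm⟩ := hm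
  obtain ⟨κ, hκ⟩ := hbΩ
  have hκ0 : 0 ≤ κ := by
    by_contra hneg
    have := hκ 0
    nlinarith [hb 0, hΩ 0]
  refine ⟨(2 * κ + 1) * ((m₀ + 1 / 2) / m₀), fun i => ?_⟩
  have hmi : 0 < p.m i := h0.trans_le (hm i)
  have hΩi := hΩ i
  have h1 : p.Ω i ≤ (m₀ + 1 / 2) / m₀ * C p i ^ 2 := by
    rw [C, mul_pow, Real.sq_sqrt (by positivity)]
    calc p.Ω i = (m₀ + 1 / 2) / m₀ * (m₀ / (m₀ + 1 / 2) * p.m i * (p.Ω i / p.m i)) := by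
          field_simp
      _ ≤ _ := by
          gcongr
          exact mul_le_Gamma_ratio_sq h0 (hm i)
  calc A p i ≤ (2 * κ + 1) * p.Ω i := by unfold A; linarith [hκ i]
    _ ≤ (2 * κ + 1) * ((m₀ + 1 / 2) / m₀ * C p i ^ 2) := by gcongr
    _ = _ := by ring

/-- The expected power of the unnormalized precoder per antenna. -/
noncomputable def precoderPower (p : Params) (K : ℕ) : ℝ :=
  ∑ i ∈ Finset.range K, B p i +
    p.ρ * ∑ i ∈ Finset.range K, ∑ j ∈ (Finset.range K).erase i, C p i * C p j

lemma sum_B_le_precoderPower (hC : ∀ i, 0 < C p i) (hρ₀ : 0 ≤ p.ρ) (K : ℕ) :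
    ∑ i ∈ Finset.range K, B p i ≤ precoderPower p K := by
  have : 0 ≤ ∑ i ∈ Finset.range K, ∑ j ∈ (Finset.range K).erase i, C p i * C p j :=
    Finset.sum_nonneg fun i _ => Finset.sum_nonneg fun j _ => (mul_pos (hC i) (hC j)).le
  unfold precoderPower
  nlinarith [mul_nonneg hρ₀ this]

/-- The off-diagonal part of the square is already present; the diagonal is paid for by ∑ B_i. This
lets the normalization absorb the common stream, whose mean power can grow like (∑ C_i)^2. -/
lemma rho_mul_sum_C_sq_le_precoderPower (hCB : ∀ i, C p i ^ 2 ≤ B p i)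
    (hρ₁ : p.ρ ≤ 1) (K : ℕ) :
    p.ρ * (∑ i ∈ Finset.range K, C p i) ^ 2 ≤ precoderPower p K := by
  have e : (∑ i ∈ Finset.range K, C p i) ^ 2 = ∑ i ∈ Finset.range K, C p i ^ 2 +
      ∑ i ∈ Finset.range K, ∑ j ∈ (Finset.range K).erase i, C p i * C p j := by
    rw [pow_two, Finset.sum_mul_sum, ← Finset.sum_add_distrib]
    refine Finset.sum_congr rfl fun i hi => ?_
    rw [← Finset.add_sum_erase _ _ hi, pow_two]
  have h1 : ∑ i ∈ Finset.range K, C p i ^ 2 ≤ ∑ i ∈ Finset.range K, B p i :=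
    Finset.sum_le_sum fun i _ => hCB i
  have h2 : 0 ≤ ∑ i ∈ Finset.range K, C p i ^ 2 := Finset.sum_nonneg fun i _ => sq_nonneg _
  rw [e, precoderPower, mul_add]
  nlinarith

end Parameters

/-! ### Numerator and denominator of the SINR and their means. -/

variable {S : Type*} [MeasurableSpace S] {μ : Measure S} {p : Params} {h e : ℕ → ℕ → S → ℂ}

/-- The received power of the common message, the numerator of the SINR. -/
noncomputable def signalPower (p : Params) (μ : Measure S) (h e : ℕ → ℕ → S → ℂ) (N K k : ℕ)
    (s : S) : ℝ :=
  alpha p μ h e N K * p.ρ *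
      ‖herm (vec h N k s) (∑ i ∈ Finset.range K, vec h N i s)‖ ^ 2
    + alpha p μ h e N K * p.ρ *
      ∑ i ∈ Finset.range K, p.errVar i * sqNorm (vec h N k s)

/-- The power of noise and interference, the denominator of the SINR. -/
noncomputable def interferencePower (p : Params) (μ : Measure S) (h e : ℕ → ℕ → S → ℂ)
    (N K k : ℕ) (s : S) : ℝ :=
  p.noiseVar k + alpha p μ h e N K * (1 - p.ρ) *
    ∑ i ∈ Finset.range K,
      (p.errVar i * sqNorm (vec h N k s) + ‖herm (vec h N k s) (vec h N i s)‖ ^ 2)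

lemma sinr_eq (N K k : ℕ) (s : S) : sinr p μ h e N K k s =
    signalPower p μ h e N K k s / interferencePower p μ h e N K k s := rfl

lemma sqNorm_nonneg {N : ℕ} (v : Fin N → ℂ) : 0 ≤ sqNorm v :=
  Finset.sum_nonneg fun _ _ => sq_nonneg _

lemma signalPower_nonneg (herr : ∀ i, 0 ≤ p.errVar i) (hρ₀ : 0 ≤ p.ρ) {N K : ℕ}
    (hα : 0 ≤ alpha p μ h e N K) (k : ℕ) (s : S) : 0 ≤ signalPower p μ h e N K k s :=
  add_nonneg (mul_nonneg (mul_nonneg hα hρ₀) (sq_nonneg _)) (mul_nonneg (mul_nonneg hα hρ₀)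
    (Finset.sum_nonneg fun i _ => mul_nonneg (herr i) (sqNorm_nonneg _)))

lemma noiseVar_le_interferencePower (herr : ∀ i, 0 ≤ p.errVar i) (hρ₁ : p.ρ ≤ 1) {N K : ℕ}
    (hα : 0 ≤ alpha p μ h e N K) (k : ℕ) (s : S) :
    p.noiseVar k ≤ interferencePower p μ h e N K k s :=
  le_add_of_nonneg_right (mul_nonneg (mul_nonneg hα (sub_nonneg.2 hρ₁))
    (Finset.sum_nonneg fun i _ =>
      add_nonneg (mul_nonneg (herr i) (sqNorm_nonneg _)) (sq_nonneg _)))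

/-- This removes the quotient of dependent variables: each logarithm can be treated separately. -/
lemma rate_eq_log_sub_log (herr : ∀ i, 0 ≤ p.errVar i) (hρ₀ : 0 ≤ p.ρ) (hρ₁ : p.ρ ≤ 1) {N K : ℕ}
    (hα : 0 ≤ alpha p μ h e N K) {k : ℕ} (hnoise : 0 < p.noiseVar k) (s : S) :
    rate p μ h e N K k s =
      (Real.log (interferencePower p μ h e N K k s + signalPower p μ h e N K k s) -
        Real.log (interferencePower p μ h e N K k s)) / Real.log 2 := by
  have hX := signalPower_nonneg herr hρ₀ hα k s
  have hY := hnoise.trans_le (noiseVar_le_interferencePower herr hρ₁ hα k s)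
  rw [rate, sinr_eq, Real.logb, one_add_div hY.ne', Real.log_div (by positivity) hY.ne']

section Expectations

variable {q f : ℕ → ℝ} (H : IndepEntries μ h (C p) (A p) q f)

include H

lemma integral_signalPower (N : ℕ) {K k : ℕ} (hk : k < K) :
    Integrable (signalPower p μ h e N K k) μ ∧ ∫ s, signalPower p μ h e N K k s ∂μ =
      alpha p μ h e N K * p.ρ * (D μ h N k
      + ∑ i ∈ (Finset.range K).erase k, (2 * (F μ h N i k).re + E μ h N k i)
      + ∑ i ∈ (Finset.range K).erase k, ∑ j ∈ ((Finset.range K).erase k).erase i,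
          (G μ h N i k j).re
      + N * A p k * ∑ i ∈ Finset.range K, p.errVar i) := by
  obtain ⟨h1, h2⟩ := H.integral_norm_herm_sum_sq N (Finset.mem_range.2 hk)
  obtain ⟨h3, h4⟩ := H.integral_sqNorm N k
  unfold signalPower
  simp only [← Finset.sum_mul]
  have h5 := h1.const_mul (alpha p μ h e N K * p.ρ)
  have h6 := (h3.const_mul (∑ i ∈ Finset.range K, p.errVar i)).const_mul
    (alpha p μ h e N K * p.ρ)
  refine ⟨h5.add h6, ?_⟩
  rw [integral_add h5 h6, integral_const_mul, integral_const_mul, integral_const_mul, h2, h4]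
  ring

lemma integral_interferencePower [IsProbabilityMeasure μ] (N : ℕ) {K k : ℕ} (hk : k < K) :
    Integrable (interferencePower p μ h e N K k) μ ∧
      ∫ s, interferencePower p μ h e N K k s ∂μ =
        p.noiseVar k + alpha p μ h e N K * (1 - p.ρ) *
        (D μ h N k + (∑ i ∈ Finset.range K, p.errVar i) * N * A p k
          + ∑ i ∈ (Finset.range K).erase k, E μ h N k i) := by
  obtain ⟨h3, h4⟩ := H.integral_sqNorm N k
  have h1 : Integrable (fun s => ∑ i ∈ Finset.range K,
      ‖herm (vec h N k s) (vec h N i s)‖ ^ 2) μ :=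
    integrable_finsetSum _ fun i _ => H.integrable_norm_herm_sq N k i
  have h2 := h3.const_mul (∑ i ∈ Finset.range K, p.errVar i)
  unfold interferencePower
  simp only [Finset.sum_add_distrib, ← Finset.sum_mul]
  have h5 : Integrable (fun s => (alpha p μ h e N K * (1 - p.ρ)) *
      ((∑ i ∈ Finset.range K, p.errVar i) * sqNorm (vec h N k s) +
        ∑ i ∈ Finset.range K, ‖herm (vec h N k s) (vec h N i s)‖ ^ 2)) μ :=
    (h2.add h1).const_mul _
  refine ⟨(integrable_const _).add h5, ?_⟩
  have hD : D μ h N k = E μ h N k k := by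
    unfold D E
    simp only [herm_self, Complex.norm_real, Real.norm_eq_abs, sq_abs]
  rw [integral_add (integrable_const _) h5, integral_const_mul, integral_add h2 h1,
    integral_const_mul, h4, integral_finsetSum _ fun i _ => H.integrable_norm_herm_sq N k i, hD,
    add_assoc (E μ h N k k), add_left_comm (E μ h N k k),
    Finset.add_sum_erase _ (E μ h N k) (Finset.mem_range.2 hk)]
  simp [E]
  ring_nf
  simp

lemma approxRate_eq_log_sub_log [IsProbabilityMeasure μ] (herr : ∀ i, 0 ≤ p.errVar i)
    (hρ₀ : 0 ≤ p.ρ) (hρ₁ : p.ρ ≤ 1) {N K k : ℕ} (hα : 0 ≤ alpha p μ h e N K)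
    (hnoise : 0 < p.noiseVar k) (hk : k < K) :
    approxRate p μ h e N K k =
      (Real.log (∫ s, (interferencePower p μ h e N K k s + signalPower p μ h e N K k s) ∂μ) -
        Real.log (∫ s, interferencePower p μ h e N K k s ∂μ)) / Real.log 2 := by
  obtain ⟨hXi, hX⟩ := integral_signalPower (e := e) H N hk
  obtain ⟨hYi, hY⟩ := integral_interferencePower (e := e) H N hk
  have hX0 : 0 ≤ ∫ s, signalPower p μ h e N K k s ∂μ :=
    integral_nonneg fun s => signalPower_nonneg herr hρ₀ hα k s
  have hY0 : 0 < ∫ s, interferencePower p μ h e N K k s ∂μ := by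
    refine hnoise.trans_le ?_
    have := integral_mono (integrable_const (p.noiseVar k)) hYi
      (noiseVar_le_interferencePower herr hρ₁ hα k)
    simpa using this
  rw [integral_add hYi hXi, approxRate, ← mul_div_assoc, ← hX, ← hY, Real.logb,
    one_add_div hY0.ne', Real.log_div (by positivity) hY0.ne']

lemma integrable_rate [IsProbabilityMeasure μ] (herr : ∀ i, 0 ≤ p.errVar i)
    (hρ₀ : 0 ≤ p.ρ) (hρ₁ : p.ρ ≤ 1) {N K k : ℕ} (hα : 0 ≤ alpha p μ h e N K)
    (hnoise : 0 < p.noiseVar k) (hk : k < K) : Integrable (rate p μ h e N K k) μ := by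
  have hXi := (integral_signalPower (e := e) H N hk).1
  have hYi := (integral_interferencePower (e := e) H N hk).1
  have hlog : ∀ {W : S → ℝ}, Integrable W μ → (∀ s, p.noiseVar k ≤ W s) →
      Integrable (fun s => Real.log (W s)) μ := by
    intro W hW hle
    -- Only integrability of the logarithm is wanted, so the tautological deviation ratio is enough
    -- and no concentration is needed.
    have hdev : RelDev μ W ((∫ s, |W s - ∫ x, W x ∂μ| ∂μ) / ∫ x, W x ∂μ) := by
      refine ⟨hW, ?_⟩
      have : p.noiseVar k ≤ ∫ x, W x ∂μ := by
        simpa using integral_mono (integrable_const (p.noiseVar k)) hW hle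
      rw [div_mul_cancel₀ _ (by linarith)]
    exact (hdev.log hnoise hle le_rfl).1
  have hYle := noiseVar_le_interferencePower herr hρ₁ hα k
  have h1 := hlog (hYi.add hXi) fun s =>
    (hYle s).trans (le_add_of_nonneg_right (signalPower_nonneg herr hρ₀ hα k s))
  have h2 := hlog hYi hYle
  refine ((h1.sub h2).div_const (Real.log 2)).congr (Eventually.of_forall fun s => ?_)
  exact (rate_eq_log_sub_log herr hρ₀ hρ₁ hα hnoise s).symm

end Expectations

end RSMA

/-! ### Uniform concentration of the powers and convergence of the rates. -/

namespace RSMA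

variable {S : Type*} [MeasurableSpace S] {μ : Measure S} {p : Params} {h e : ℕ → ℕ → S → ℂ}

/-- An inequality rather than an equality, so that it also covers a vanishing denominator, where
division by zero makes α equal to 0. -/
lemma IsChannelModel.alpha_mul_precoderPower (H : IsChannelModel p μ h e) (hm : ∀ i, 0 < p.m i)
    (hΩ : ∀ i, 0 < p.Ω i) (hb : ∀ i, 0 ≤ p.b i) (herr : ∀ i, 0 ≤ p.errVar i) (hPt : 0 < p.Pt)
    (hρ₀ : 0 ≤ p.ρ) (hρ₁ : p.ρ ≤ 1) (N : ℕ) {K : ℕ} :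
    0 ≤ alpha p μ h e N K ∧ alpha p μ h e N K * (N * precoderPower p K) ≤ p.Pt := by
  have hB : ∀ i, 0 ≤ B p i := fun i => by
    have := hb i; have := herr i; have := hΩ i
    unfold B
    positivity
  have hS : 0 ≤ precoderPower p K :=
    (Finset.sum_nonneg fun i _ => hB i).trans (sum_B_le_precoderPower (C_pos hm hΩ) hρ₀ K)
  have e1 : alpha p μ h e N K = p.Pt / (N * precoderPower p K) := by
    rw [H.alpha_eq hm hΩ hb herr hρ₀ hρ₁, precoderPower]
    ring
  rw [e1]
  refine ⟨by positivity, ?_⟩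
  rcases eq_or_ne (N * precoderPower p K) 0 with h0 | h0
  · rw [h0, mul_zero]
    exact hPt.le
  · rw [div_mul_cancel₀ _ h0]

/-- The numerator and the denominator of the SINR concentrate at rate `1 / √N`, uniformly in the
number of users, and their means grow at most linearly in `N`. -/
lemma IsChannelModel.exists_relDev [IsProbabilityMeasure μ] (H : IsChannelModel p μ h e)
    (hm : ∃ m₀ : ℝ, 0 < m₀ ∧ ∀ i, m₀ ≤ p.m i)
    (hΩ : ∀ i, 0 < p.Ω i) (hb : ∀ i, 0 ≤ p.b i) (hbΩ : ∃ κ : ℝ, ∀ i, p.b i ≤ κ * p.Ω i)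
    (herr : ∀ i, 0 ≤ p.errVar i) (hPt : 0 < p.Pt) (hρ₀ : 0 ≤ p.ρ) (hρ₁ : p.ρ ≤ 1)
    {k : ℕ} (hnoise : 0 < p.noiseVar k) :
    ∃ R L : ℝ, 0 < L ∧ ∀ N K : ℕ, 1 ≤ N → k < K →
      RelDev μ (interferencePower p μ h e N K k) (R / Real.sqrt N) ∧
      RelDev μ (fun s => interferencePower p μ h e N K k s + signalPower p μ h e N K k s)
        (R / Real.sqrt N) ∧
      ∫ s, interferencePower p μ h e N K k s ∂μ ≤ L * N ∧
      ∫ s, (interferencePower p μ h e N K k s + signalPower p μ h e N K k s) ∂μ ≤ L * N := by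
  obtain ⟨M, hM⟩ := exists_A_le_mul_C_sq hm hΩ hb hbΩ
  have hm' : ∀ i, 0 < p.m i := fun i => by
    obtain ⟨m₀, h0, h1⟩ := hm
    exact h0.trans_le (h1 i)
  have hE := H.indepEntries hm' hΩ hb
  have hC := C_pos hm' hΩ
  have hCA := hE.sq_mean_le
  have hA0 : ∀ i, 0 < A p i := fun i => (pow_pos (hC i) 2).trans_le (hCA i)
  have hAB : ∀ i, A p i ≤ B p i := fun i => by
    unfold A B
    linarith [herr i]
  have heB : ∀ i, p.errVar i ≤ B p i := fun i => by
    unfold B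
    linarith [hb i, hΩ i]
  obtain ⟨β, κ, hκ, hT⟩ := hE.exists_meanVarBound hC hM k
  set γ := C p k with hγ
  have hγ0 : 0 < γ := hC k
  set R₁ := 3 * (κ / γ ^ 2) + 1 with hR₁
  set R₂ := fourthMoment p k / A p k ^ 2 + 1 with hR₂
  have hq := hE.fourth_nonneg k
  have hR₁0 : 0 ≤ R₁ := by positivity
  have hR₂0 : 0 ≤ R₂ := by positivity
  set Q := β ^ 2 + κ with hQ
  have hQ0 : 0 ≤ Q := by positivity
  -- R₁ comes from the inner products and R₂ from the norm of the channel of user k. The factor 2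
  -- counts signal and interference, each with mean at most Pt (A_k + Q) N besides the noise.
  refine ⟨R₁ + R₂, p.noiseVar k + 2 * (p.Pt * (A p k + Q)), ?_, fun N K hN hk => ?_⟩
  · have := hA0 k
    positivity
  have hN' : (1 : ℝ) ≤ N := by exact_mod_cast hN
  have hs0 : 0 < Real.sqrt N := Real.sqrt_pos.2 (by linarith)
  obtain ⟨hα, hαS⟩ := H.alpha_mul_precoderPower hm' hΩ hb herr hPt hρ₀ hρ₁ N (K := K)
  set α := alpha p μ h e N K with hαdef
  have hBS := sum_B_le_precoderPower hC hρ₀ K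
  have hCS := rho_mul_sum_C_sq_le_precoderPower (fun i => (hCA i).trans (hAB i)) hρ₁ K
  have hr0 : 0 ≤ (R₁ + R₂) / Real.sqrt N := by positivity
  have hle₁ : R₁ / Real.sqrt N ≤ (R₁ + R₂) / Real.sqrt N := by gcongr; linarith
  have hle₂ : R₂ / Real.sqrt N ≤ (R₁ + R₂) / Real.sqrt N := by gcongr; linarith
  -- the total of the products with all users
  have hsum : MeanVarBound μ (fun s => herm (vec h N k s) (∑ i ∈ Finset.range K, vec h N i s)) N
      (∑ i ∈ Finset.range K, C p i) γ β κ := by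
    have hI := (hE.integral_norm_herm_sum_sq N (Finset.mem_range.2 hk)).1
    simp only [herm_sum] at hI ⊢
    exact MeanVarBound.sum hC (hT N) hI
  have hsC : 0 ≤ ∑ i ∈ Finset.range K, C p i := Finset.sum_nonneg fun i _ => (hC i).le
  have d1 := (hsum.relDev hN' hsC hγ0 hκ).mono (integral_nonneg fun s => sq_nonneg _) hle₁
  have d2 := (hE.sqNorm_relDev (hA0 k) hN).mono (integral_nonneg fun s => sqNorm_nonneg _) hle₂
  have d3 := fun i => ((hT N i).relDev hN' (hC i).le hγ0 hκ).mono
    (integral_nonneg fun s => sq_nonneg _) hle₁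
  have dX : RelDev μ (signalPower p μ h e N K k) ((R₁ + R₂) / Real.sqrt N) :=
    (d1.const_mul (mul_nonneg hα hρ₀)).add ((RelDev.sum _ hr0 fun i _ =>
      d2.const_mul (herr i)).const_mul (mul_nonneg hα hρ₀))
  have dY : RelDev μ (interferencePower p μ h e N K k) ((R₁ + R₂) / Real.sqrt N) :=
    (RelDev.const hr0 hnoise.le).add ((RelDev.sum _ hr0 fun i _ =>
      (d2.const_mul (herr i)).add (d3 i)).const_mul (mul_nonneg hα (sub_nonneg.2 hρ₁)))
  -- the part of the power due to the estimation errors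
  have b0 : α * ((∑ i ∈ Finset.range K, p.errVar i) * (N * A p k)) ≤ p.Pt * A p k * N := by
    have h1 : ∑ i ∈ Finset.range K, p.errVar i ≤ precoderPower p K :=
      (Finset.sum_le_sum fun i _ => heB i).trans hBS
    have hAk := hA0 k
    calc α * ((∑ i ∈ Finset.range K, p.errVar i) * (N * A p k))
        ≤ α * (precoderPower p K * (N * A p k)) := by gcongr
      _ = (α * (N * precoderPower p K)) * A p k := by ring
      _ ≤ p.Pt * A p k := by gcongr
      _ ≤ p.Pt * A p k * N := le_mul_of_one_le_right (by positivity) hN'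
  have bX : ∫ s, signalPower p μ h e N K k s ∂μ ≤ p.Pt * (A p k + Q) * N := by
    have h1 := hsum.integral_norm_sq_le hN' hsC hγ0.le hκ
    have e1 : ∫ s, signalPower p μ h e N K k s ∂μ =
        α * p.ρ * ∫ s, ‖herm (vec h N k s) (∑ i ∈ Finset.range K, vec h N i s)‖ ^ 2 ∂μ +
          p.ρ * (α * ((∑ i ∈ Finset.range K, p.errVar i) * (N * A p k))) := by
      rw [(integral_signalPower hE N hk).2,
        (hE.integral_norm_herm_sum_sq N (Finset.mem_range.2 hk)).2]
      ring
    have hsP : 0 ≤ ∑ i ∈ Finset.range K, p.errVar i := Finset.sum_nonneg fun i _ => herr i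
    have h2 : α * p.ρ * ∫ s, ‖herm (vec h N k s) (∑ i ∈ Finset.range K, vec h N i s)‖ ^ 2 ∂μ ≤
        p.Pt * Q * N := by
      calc _ ≤ α * p.ρ * ((N : ℝ) ^ 2 * Q * (∑ i ∈ Finset.range K, C p i) ^ 2) := by gcongr
        _ = α * N ^ 2 * Q * (p.ρ * (∑ i ∈ Finset.range K, C p i) ^ 2) := by ring
        _ ≤ α * N ^ 2 * Q * precoderPower p K := by gcongr
        _ = (α * (N * precoderPower p K)) * (Q * N) := by ring
        _ ≤ p.Pt * (Q * N) := by gcongr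
        _ = p.Pt * Q * N := by ring
    have h3 : p.ρ * (α * ((∑ i ∈ Finset.range K, p.errVar i) * (N * A p k))) ≤
        p.Pt * A p k * N := by
      have hAk := hA0 k
      have h4 : 0 ≤ α * ((∑ i ∈ Finset.range K, p.errVar i) * (N * A p k)) := by positivity
      exact (mul_le_of_le_one_left h4 hρ₁).trans b0
    rw [e1]
    linarith
  have bY : ∫ s, interferencePower p μ h e N K k s ∂μ ≤
      p.noiseVar k * N + p.Pt * (A p k + Q) * N := by
    have e1 : ∫ s, interferencePower p μ h e N K k s ∂μ = p.noiseVar k + (1 - p.ρ) *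
        (α * ((∑ i ∈ Finset.range K, p.errVar i) * (N * A p k)) +
          α * ∑ i ∈ Finset.range K, ∫ s, ‖herm (vec h N k s) (vec h N i s)‖ ^ 2 ∂μ) := by
      have h3 := hE.integrable_norm_herm_sq N k
      obtain ⟨h4, h5⟩ := hE.integral_sqNorm N k
      have h6 : ∀ i, Integrable (fun s => p.errVar i * sqNorm (vec h N k s) +
          ‖herm (vec h N k s) (vec h N i s)‖ ^ 2) μ := fun i => (h4.const_mul _).add (h3 i)
      unfold interferencePower
      rw [integral_add (integrable_const _) ((integrable_finsetSum _ fun i _ => h6 i).const_mul _),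
        integral_const_mul, integral_finsetSum _ fun i _ => h6 i]
      have h7 : ∀ i, ∫ s, (p.errVar i * sqNorm (vec h N k s) +
          ‖herm (vec h N k s) (vec h N i s)‖ ^ 2) ∂μ = p.errVar i * (N * A p k) +
            ∫ s, ‖herm (vec h N k s) (vec h N i s)‖ ^ 2 ∂μ := by
        intro i
        rw [integral_add (h4.const_mul _) (h3 i), integral_const_mul, h5]
      simp only [h7, Finset.sum_add_distrib, ← Finset.sum_mul, integral_const, probReal_univ,
        smul_eq_mul, one_mul]
      ring
    have h2 : α * ∑ i ∈ Finset.range K, ∫ s, ‖herm (vec h N k s) (vec h N i s)‖ ^ 2 ∂μ ≤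
        p.Pt * Q * N := by
      have h3 : ∑ i ∈ Finset.range K, ∫ s, ‖herm (vec h N k s) (vec h N i s)‖ ^ 2 ∂μ ≤
          N ^ 2 * Q * precoderPower p K := by
        -- The private streams add powers rather than amplitudes, so C_i^2 ≤ B_i and ∑ B_i suffice
        -- here.
        refine le_trans ?_ (mul_le_mul_of_nonneg_left hBS (by positivity))
        rw [Finset.mul_sum]
        refine Finset.sum_le_sum fun i _ =>
          ((hT N i).integral_norm_sq_le hN' (hC i).le hγ0.le hκ).trans ?_
        gcongr
        exact (hCA i).trans (hAB i)
      calc _ ≤ α * (N ^ 2 * Q * precoderPower p K) := by gcongr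
        _ = (α * (N * precoderPower p K)) * (Q * N) := by ring
        _ ≤ p.Pt * (Q * N) := by gcongr
        _ = p.Pt * Q * N := by ring
    have h3 : (1 - p.ρ) * (α * ((∑ i ∈ Finset.range K, p.errVar i) * (N * A p k)) +
        α * ∑ i ∈ Finset.range K, ∫ s, ‖herm (vec h N k s) (vec h N i s)‖ ^ 2 ∂μ) ≤
        p.Pt * A p k * N + p.Pt * Q * N := by
      have hAk := hA0 k
      have hsP : 0 ≤ ∑ i ∈ Finset.range K, p.errVar i := Finset.sum_nonneg fun i _ => herr i
      have h5 : 0 ≤ ∑ i ∈ Finset.range K, ∫ s, ‖herm (vec h N k s) (vec h N i s)‖ ^ 2 ∂μ :=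
        Finset.sum_nonneg fun i _ => integral_nonneg fun s => sq_nonneg _
      exact (mul_le_of_le_one_left (by positivity) (by linarith)).trans (add_le_add b0 h2)
    have h4 : p.noiseVar k ≤ p.noiseVar k * N := le_mul_of_one_le_right hnoise.le hN'
    rw [e1]
    linarith
  have hpos : 0 ≤ p.Pt * (A p k + Q) * N := by
    have hAk := hA0 k
    positivity
  refine ⟨dY, dY.add dX, by linarith, ?_⟩
  rw [integral_add dY.integrable dX.integrable]
  linarith

/-- The ergodic rate is asymptotically the rate computed from the mean powers. -/
lemma IsChannelModel.tendsto_approxRate_sub_ergodicRate [IsProbabilityMeasure μ]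
    (H : IsChannelModel p μ h e) (hm : ∃ m₀ : ℝ, 0 < m₀ ∧ ∀ i, m₀ ≤ p.m i)
    (hΩ : ∀ i, 0 < p.Ω i) (hb : ∀ i, 0 ≤ p.b i) (hbΩ : ∃ κ : ℝ, ∀ i, p.b i ≤ κ * p.Ω i)
    (herr : ∀ i, 0 ≤ p.errVar i) (hPt : 0 < p.Pt) (hρ₀ : 0 ≤ p.ρ) (hρ₁ : p.ρ ≤ 1)
    {k : ℕ} (hnoise : 0 < p.noiseVar k) :
    Tendsto (fun x : ℕ × ℕ => approxRate p μ h e x.1 x.2 k - ergodicRate p μ h e x.1 x.2 k)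
      (atTop ×ˢ atTop) (𝓝 0) := by
  obtain ⟨R, L, hL, hRL⟩ := H.exists_relDev hm hΩ hb hbΩ herr hPt hρ₀ hρ₁ hnoise
  have hm' : ∀ i, 0 < p.m i := fun i => by
    obtain ⟨m₀, h0, h1⟩ := hm
    exact h0.trans_le (h1 i)
  have hE := H.indepEntries hm' hΩ hb
  -- The error bound depends on N alone, so no relation between N and K is needed. The 2 counts the
  -- two logarithms and log 2 changes the base.
  have hlim := ((tendsto_log_mul_div_sqrt hL hnoise R).const_mul (2 / Real.log 2)).comp
    (tendsto_fst (f := (atTop : Filter ℕ)) (g := (atTop : Filter ℕ)))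
  rw [mul_zero] at hlim
  refine squeeze_zero_norm' ?_ hlim
  have hev : ∀ᶠ x : ℕ × ℕ in atTop ×ˢ atTop, 1 ≤ x.1 ∧ k < x.2 :=
    (eventually_ge_atTop 1).prod_mk (eventually_gt_atTop k)
  filter_upwards [hev] with x hx
  obtain ⟨N, K⟩ := x
  obtain ⟨hN, hk⟩ := hx
  obtain ⟨hα, -⟩ := H.alpha_mul_precoderPower hm' hΩ hb herr hPt hρ₀ hρ₁ N (K := K)
  obtain ⟨dY, dYX, bY, bYX⟩ := hRL N K hN hk
  have hYle := noiseVar_le_interferencePower herr hρ₁ hα k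
  obtain ⟨i1, l1⟩ := dY.log hnoise hYle bY
  obtain ⟨i2, l2⟩ := dYX.log hnoise (fun s => (hYle s).trans
    (le_add_of_nonneg_right (signalPower_nonneg herr hρ₀ hα k s))) bYX
  have hlog2 : 0 < Real.log 2 := Real.log_pos one_lt_two
  simp only [Function.comp_apply, ergodicRate, rate_eq_log_sub_log herr hρ₀ hρ₁ hα hnoise]
  rw [approxRate_eq_log_sub_log hE herr hρ₀ hρ₁ hα hnoise hk, integral_div, integral_sub i2 i1,
    ← sub_div, Real.norm_eq_abs, abs_div, abs_of_pos hlog2, div_mul_eq_mul_div]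
  gcongr
  rw [abs_le] at l1 l2 ⊢
  constructor <;> linarith [l1.1, l1.2, l2.1, l2.2]

end RSMA

theorem theorem1 {S : Type*} [MeasurableSpace S] (μ : Measure S) [IsProbabilityMeasure μ]
    (p : RSMA.Params) (h e : ℕ → ℕ → S → ℂ) (hmodel : RSMA.IsChannelModel p μ h e)
    (hm : ∃ m₀ : ℝ, 0 < m₀ ∧ ∀ i, m₀ ≤ p.m i)
    (hΩ : ∀ i, 0 < p.Ω i)
    (hb : ∀ i, 0 ≤ p.b i)
    (hbΩ : ∃ κ : ℝ, ∀ i, p.b i ≤ κ * p.Ω i)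
    (herr : ∀ i, 0 ≤ p.errVar i)
    (hPt : 0 < p.Pt) (hρ₀ : 0 ≤ p.ρ) (hρ₁ : p.ρ ≤ 1)
    (k : ℕ) (hnoise : 0 < p.noiseVar k) :
    -- the ergodic rate of user `k` is a genuine expectation
    (∀ N K, k < K → Integrable (RSMA.rate p μ h e N K k) μ) ∧
    -- the approximation converges to the ergodic rate
    Tendsto (fun x : ℕ × ℕ =>
        RSMA.approxRate p μ h e x.1 x.2 k - RSMA.ergodicRate p μ h e x.1 x.2 k)
      (atTop ×ˢ atTop) (𝓝 0) ∧
    -- all the quantities in the approximation are explicit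
    (∀ i t, ∫ s, ‖h i t s‖ ^ 2 ∂μ = RSMA.A p i ∧
      ∫ s, ‖h i t s + e i t s‖ ^ 2 ∂μ = RSMA.B p i ∧
      ∫ s, (h i t s + e i t s) ∂μ = (RSMA.C p i : ℂ)) ∧
    (∀ N K, RSMA.alpha p μ h e N K =
      p.Pt / (N * ∑ i ∈ Finset.range K, RSMA.B p i
        + p.ρ * N * ∑ i ∈ Finset.range K, ∑ j ∈ (Finset.range K).erase i,
            RSMA.C p i * RSMA.C p j)) ∧
    (∀ N : ℕ, RSMA.D μ h N k =
      N * (4 * p.b k ^ 2 + 4 * p.b k * p.Ω k + p.Ω k ^ 2 / p.m k)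
        + (N : ℝ) ^ 2 * RSMA.A p k ^ 2) ∧
    (∀ N i, i ≠ k → RSMA.E μ h N k i =
      N * RSMA.A p k * RSMA.A p i
        + N * ((N : ℝ) - 1) * RSMA.C p k ^ 2 * RSMA.C p i ^ 2) ∧
    (∀ N i, i ≠ k → RSMA.F μ h N i k =
      ((N * RSMA.C p i *
        (Real.Gamma (p.m k + 3 / 2) / Real.Gamma (p.m k) * (p.Ω k / p.m k) ^ (3 / 2 : ℝ)
          + 4 * p.b k * RSMA.C p k
          + RSMA.C p k * ((N : ℝ) - 1) * RSMA.A p k) : ℝ) : ℂ)) ∧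
    (∀ N i j, i ≠ k → j ≠ k → i ≠ j → RSMA.G μ h N i k j =
      ((N * RSMA.C p i * RSMA.C p j *
        (RSMA.A p k + ((N : ℝ) - 1) * RSMA.C p k ^ 2) : ℝ) : ℂ)) := by
  have hm' : ∀ i, 0 < p.m i := fun i => by
    obtain ⟨m₀, h0, h1⟩ := hm
    exact h0.trans_le (h1 i)
  have hE := hmodel.indepEntries hm' hΩ hb
  refine ⟨fun N K hk => ?_, hmodel.tendsto_approxRate_sub_ergodicRate hm hΩ hb hbΩ herr hPt hρ₀ hρ₁
    hnoise, fun i t => ⟨hE.sq i t, (hmodel.estimate_sq hm' hΩ hb herr i t).2,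
    (hmodel.estimate_mean hm' hΩ hb herr i t).2⟩, hmodel.alpha_eq hm' hΩ hb herr hρ₀ hρ₁,
    fun N => ?_, fun N i hik => hE.E_eq N hik, fun N i hik => hE.F_eq N hik,
    fun N i j hik hjk hij => hE.G_eq N hik hjk hij⟩
  · exact RSMA.integrable_rate hE herr hρ₀ hρ₁
      (hmodel.alpha_mul_precoderPower hm' hΩ hb herr hPt hρ₀ hρ₁ N).1 hnoise hk
  · rw [hE.D_eq, RSMA.fourthMoment, add_sub_cancel_right]
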